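/- A skew algebra is a skew lattice $(A,\wedge,\vee)$ (idempotent associative operations satisfying $x\wedge(x\vee y)=x=(y\vee x)\wedge x$ and $x\vee(x\wedge y)=x=(y\wedge x)\vee x$) in which $\wedge$ distributes over $\vee$ on both sides, with a zero $0$ neutral for $\vee$, an operation $\setminus$ with $(x\setminus y)\wedge(x\wedge y\wedge x)=0$ and $(x\setminus y)\vee(x\wedge y\wedge x)=x$, and an operation $\cap$ giving greatest lower bounds for the natural partial order $x\le y\iff x\wedge y=y\wedge x=x$. It is right-handed if $x\wedge y\wedge x=y\wedge x$. Homomorphisms preserve $0,\wedge,\vee,\setminus,\cap$. A $\le$-ideal is a subset closed under finite joins (so it contains $0$) and downward closed for $\le$; it is a subalgebra. A skew Boolean space is a surjective étale map $p:E\to B$ between Boolean spaces (locally compact zero-dimensional Hausdorff spaces). A morphism from $p:E\to B$ to $p':E'\to B'$ is a pair $(g,h)$ of proper continuous partial maps $g:E\rightharpoonup E'$, $h:B\rightharpoonup B'$ with open domains such that $p(\mathrm{dom}\,g)=\mathrm{dom}\,h$, $p'(g(e))=h(p(e))$ for $e\in\mathrm{dom}\,g$, and $g$ maps $E_x\cap\mathrm{dom}\,g$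 bijectively onto $E'_{h(x)}$ for all $x\in\mathrm{dom}\,h$. For $U\subseteq E$ open, the partial identity on $U$ is the morphism from $p$ to $p|_U:U\to p(U)$ consisting of the partial maps $E\rightharpoonup U$ and $B\rightharpoonup p(U)$ that are the identity on their domains $U$ and $p(U)$. Let $\mathbf A$ be the contravariant functor taking $p$ to the right-handed skew algebra $A_p$ of compact open $S\subseteq E$ on which $p$ is injective, with $0=\emptyset$, $S\wedge R=\sigma(S)\cap R$, $S\vee R=S\cup(R-\sigma(S))$, $S\setminus R=S-\sigma(R)$ and $S\cap R$ the intersection, where $\sigma(S)=p^{-1}(p(S))$, and taking $(g,h)$ to $S\mapsto g^{-1}(S)$. For a right-handed skew algebra $A$, a prime ideal is a proper subset $P$ closed under finite joins, downward closed for $x\preceq y\iff x\wedge y\wedge x=x$, with $a\wedge b\in P\Rightarrow a\in P$ or $b\in P$. The spectrum of $A$ is the set of prime ideals with basic open sets $N_a=\{P: a\notin P\}$. The skew spectrum is the set of $P_t=(P,[t]_{\theta_P})$ with $P$ prime and $t\notin P$, where $\theta_P$ is the least congruence whose zero-class contains $P$, with basic open sets $M_a=\{P_a: a\notin P\}$.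 Let $q_A(P_t)=P$. For a homomorphism $f:A\to A'$ let $f_\downarrow(P)=f^{-1}(P)$, defined when $f^{-1}(P)\ne A$, and $f^\uparrow(P_{f(a)})=(f^{-1}(P))_a$, defined at the points $P_{f(a)}$ with $f(a)\notin P$. Theorem. The assignment $A\mapsto q_A$, $f\mapsto(f^\uparrow,f_\downarrow)$ is a well-defined contravariant functor $\mathbf S$ from right-handed skew algebras to skew Boolean spaces. The functors $\mathbf A$ and $\mathbf S$ form a duality between skew Boolean spaces and right-handed skew algebras, and this duality restricts to a duality between the category of skew Boolean spaces and partial identities with open domains (up to isomorphism of the target) and the category of right-handed skew algebras and inclusions of $\le$-ideals (up to isomorphism of the source). More precisely: 1. A morphism $(g,h)$ is, up to isomorphism of the target, a partial identity with open domain if and only if $\mathbf A(g,h)$ is, up to isomorphism of the source, the inclusion of a $\le$-ideal. A homomorphism $f$ is, up to isomorphism of the source, the inclusion of a $\le$-ideal if and only if $\mathbf S(f)$ is, up to isomorphism of the target, a partial identity with open domain. 2. These two classes of morphisms are closed under composition and contain the identities, and $\mathbf A$ and $\mathbf S$ restrict to mutually quasi-inverse contravariant equivalences of the corresponding wide subcategories.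 3. For each skew Boolean space $p:E\to B$, the map $U\mapsto\{S\in A_p: S\subseteq U\}$ is an order isomorphism from the open subsets of $E$ onto the $\le$-ideals of $A_p$, and $\mathbf A$ takes the partial identity on $U$ to the inclusion of this $\le$-ideal, up to isomorphism of the source. 4. For each right-handed skew algebra $A$, the map $I\mapsto\bigcup_{a\in I}M_a$ is an order isomorphism from the $\le$-ideals of $A$ onto the open subsets of the skew spectrum, and $\mathbf S$ takes the inclusion of $I$ to the partial identity on this open set, up to isomorphism of the target. -/

import Mathlib

open CategoryTheory Opposite TopologicalSpace

universe u

namespace SkewStone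

/-! ## Skew Boolean algebras with intersections -/

/-- Skew lattices: idempotent associative meet and join satisfying the absorption identities. -/
class SkewLattice (A : Type u) where
  meet : A → A → A
  join : A → A → A
  meet_self : ∀ x, meet x x = x
  join_self : ∀ x, join x x = x
  meet_assoc : ∀ x y z, meet (meet x y) z = meet x (meet y z)
  join_assoc : ∀ x y z, join (join x y) z = join x (join y z)
  meet_join_absorb : ∀ x y, meet x (join x y) = x
  join_meet_absorb : ∀ x y, meet (join y x) x = x
  join_meet_absorb' : ∀ x y, join x (meet x y) = x
  meet_join_absorb' : ∀ x y, join (meet y x) x = x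

infixl:70 " ⊼ₛ " => SkewLattice.meet
infixl:65 " ⊻ₛ " => SkewLattice.join

/-- The natural partial order `x ≤ y` of a skew lattice. -/
def NatLe {A : Type u} [SkewLattice A] (x y : A) : Prop := x ⊼ₛ y = x ∧ y ⊼ₛ x = x

/-- The natural preorder `x ≼ y` of a skew lattice. -/
def NatPre {A : Type u} [SkewLattice A] (x y : A) : Prop := x ⊼ₛ y ⊼ₛ x = x

/-- Skew Boolean algebras with intersections, called skew algebras for short. The operation
`inter` is the greatest lower bound for the natural partial order. -/
class SkewAlgebra (A : Type u) extends SkewLattice A, Zero A where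
  diff : A → A → A
  inter : A → A → A
  meet_join_distrib : ∀ x y z : A, x ⊼ₛ (y ⊻ₛ z) = (x ⊼ₛ y) ⊻ₛ (x ⊼ₛ z)
  join_meet_distrib : ∀ x y z : A, (y ⊻ₛ z) ⊼ₛ x = (y ⊼ₛ x) ⊻ₛ (z ⊼ₛ x)
  zero_join : ∀ x : A, 0 ⊻ₛ x = x
  join_zero : ∀ x : A, x ⊻ₛ 0 = x
  diff_meet : ∀ x y : A, diff x y ⊼ₛ (x ⊼ₛ y ⊼ₛ x) = 0
  diff_join : ∀ x y : A, diff x y ⊻ₛ (x ⊼ₛ y ⊼ₛ x) = x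
  inter_le_left : ∀ x y : A, NatLe (inter x y) x
  inter_le_right : ∀ x y : A, NatLe (inter x y) y
  le_inter : ∀ x y z : A, NatLe z x → NatLe z y → NatLe z (inter x y)

infixl:70 " ∖ₛ " => SkewAlgebra.diff
infixl:70 " ∩ₛ " => SkewAlgebra.inter

section lemmas

variable {A : Type u} [SkewAlgebra A]

theorem zero_meet (x : A) : (0 : A) ⊼ₛ x = 0 := by
  have h := SkewLattice.meet_join_absorb (0 : A) x
  rwa [SkewAlgebra.zero_join] at h

theorem meet_zero (x : A) : x ⊼ₛ (0 : A) = 0 := by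
  have h := SkewLattice.join_meet_absorb (0 : A) x
  rwa [SkewAlgebra.join_zero] at h

theorem meet_le_join (x y : A) : NatLe (x ⊼ₛ y) (y ⊻ₛ x) := by
  constructor
  · rw [SkewLattice.meet_assoc, SkewLattice.meet_join_absorb]
  · rw [← SkewLattice.meet_assoc, SkewLattice.join_meet_absorb]

theorem diff_le (x y : A) : NatLe (x ∖ₛ y) x := by
  set a := x ∖ₛ y with ha
  set b := x ⊼ₛ y ⊼ₛ x with hb
  have h1 : a ⊼ₛ b = 0 := SkewAlgebra.diff_meet x y
  have h2 : a ⊻ₛ b = x := SkewAlgebra.diff_join x y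
  have h3 : b ⊼ₛ a = 0 := by
    rw [← SkewLattice.meet_self (b ⊼ₛ a), SkewLattice.meet_assoc, ← SkewLattice.meet_assoc a b a,
      h1, zero_meet, meet_zero]
  constructor
  · nth_rw 1 [← h2]
    exact SkewLattice.meet_join_absorb a b
  · nth_rw 1 [← h2]
    rw [SkewAlgebra.join_meet_distrib, h3, SkewLattice.meet_self, SkewAlgebra.join_zero]

end lemmas

/-- Homomorphisms of skew algebras preserve all the operations. -/
@[ext]
structure SkewHom (A B : Type u) [SkewAlgebra A] [SkewAlgebra B] where
  toFun : A → B
  map_zero : toFun 0 = 0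
  map_meet : ∀ x y, toFun (x ⊼ₛ y) = toFun x ⊼ₛ toFun y
  map_join : ∀ x y, toFun (x ⊻ₛ y) = toFun x ⊻ₛ toFun y
  map_diff : ∀ x y, toFun (x ∖ₛ y) = toFun x ∖ₛ toFun y
  map_inter : ∀ x y, toFun (x ∩ₛ y) = toFun x ∩ₛ toFun y

/-- Right-handed skew algebras. -/
structure RSkewAlg : Type (u + 1) where
  carrier : Type u
  [str : SkewAlgebra carrier]
  rightHanded : ∀ x y : carrier, x ⊼ₛ y ⊼ₛ x = y ⊼ₛ x

instance : CoeSort RSkewAlg.{u} (Type u) := ⟨RSkewAlg.carrier⟩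

instance (A : RSkewAlg.{u}) : SkewAlgebra A := A.str

/-- The category of right-handed skew algebras and all homomorphisms. -/
instance : Category.{u} RSkewAlg.{u} where
  Hom A B := SkewHom A B
  id A := ⟨fun x => x, rfl, fun _ _ => rfl, fun _ _ => rfl, fun _ _ => rfl, fun _ _ => rfl⟩
  comp {A B C} f g :=
    ⟨fun x => g.toFun (f.toFun x), by rw [f.map_zero, g.map_zero],
      fun x y => by rw [f.map_meet, g.map_meet],
      fun x y => by rw [f.map_join, g.map_join],
      fun x y => by rw [f.map_diff, g.map_diff],
      fun x y => by rw [f.map_inter, g.map_inter]⟩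

/-! ## Ideals for the natural partial order and their inclusions -/

/-- A `≤`-ideal: closed under finite joins and downward closed for the natural partial order. -/
@[ext]
structure LeIdeal (A : Type u) [SkewAlgebra A] where
  carrier : Set A
  zero_mem : (0 : A) ∈ carrier
  join_mem : ∀ {x y : A}, x ∈ carrier → y ∈ carrier → x ⊻ₛ y ∈ carrier
  lower : ∀ {x y : A}, NatLe x y → y ∈ carrier → x ∈ carrier

namespace LeIdeal

instance (A : Type u) [SkewAlgebra A] : LE (LeIdeal A) := ⟨fun I J => I.carrier ⊆ J.carrier⟩

variable {A : Type u} [SkewAlgebra A] (I : LeIdeal A)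

theorem meet_mem {x y : A} (hx : x ∈ I.carrier) (hy : y ∈ I.carrier) : x ⊼ₛ y ∈ I.carrier :=
  I.lower (meet_le_join x y) (I.join_mem hy hx)

/-- A `≤`-ideal is a subalgebra. -/
instance : SkewAlgebra I.carrier where
  meet x y := ⟨x.1 ⊼ₛ y.1, I.meet_mem x.2 y.2⟩
  join x y := ⟨x.1 ⊻ₛ y.1, I.join_mem x.2 y.2⟩
  zero := ⟨0, I.zero_mem⟩
  diff x y := ⟨x.1 ∖ₛ y.1, I.lower (diff_le x.1 y.1) x.2⟩
  inter x y := ⟨x.1 ∩ₛ y.1, I.lower (SkewAlgebra.inter_le_left x.1 y.1) x.2⟩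
  meet_self x := Subtype.ext (SkewLattice.meet_self x.1)
  join_self x := Subtype.ext (SkewLattice.join_self x.1)
  meet_assoc x y z := Subtype.ext (SkewLattice.meet_assoc x.1 y.1 z.1)
  join_assoc x y z := Subtype.ext (SkewLattice.join_assoc x.1 y.1 z.1)
  meet_join_absorb x y := Subtype.ext (SkewLattice.meet_join_absorb x.1 y.1)
  join_meet_absorb x y := Subtype.ext (SkewLattice.join_meet_absorb x.1 y.1)
  join_meet_absorb' x y := Subtype.ext (SkewLattice.join_meet_absorb' x.1 y.1)
  meet_join_absorb' x y := Subtype.ext (SkewLattice.meet_join_absorb' x.1 y.1)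
  meet_join_distrib x y z := Subtype.ext (SkewAlgebra.meet_join_distrib x.1 y.1 z.1)
  join_meet_distrib x y z := Subtype.ext (SkewAlgebra.join_meet_distrib x.1 y.1 z.1)
  zero_join x := Subtype.ext (SkewAlgebra.zero_join x.1)
  join_zero x := Subtype.ext (SkewAlgebra.join_zero x.1)
  diff_meet x y := Subtype.ext (SkewAlgebra.diff_meet x.1 y.1)
  diff_join x y := Subtype.ext (SkewAlgebra.diff_join x.1 y.1)
  inter_le_left x y :=
    ⟨Subtype.ext (SkewAlgebra.inter_le_left x.1 y.1).1,
      Subtype.ext (SkewAlgebra.inter_le_left x.1 y.1).2⟩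
  inter_le_right x y :=
    ⟨Subtype.ext (SkewAlgebra.inter_le_right x.1 y.1).1,
      Subtype.ext (SkewAlgebra.inter_le_right x.1 y.1).2⟩
  le_inter x y z h1 h2 :=
    have h := SkewAlgebra.le_inter x.1 y.1 z.1
      ⟨congrArg Subtype.val h1.1, congrArg Subtype.val h1.2⟩
      ⟨congrArg Subtype.val h2.1, congrArg Subtype.val h2.2⟩
    ⟨Subtype.ext h.1, Subtype.ext h.2⟩

end LeIdeal

/-- A `≤`-ideal of a right-handed skew algebra, as a right-handed skew algebra. -/
def idealObj (A : RSkewAlg.{u}) (I : LeIdeal A) : RSkewAlg.{u} where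
  carrier := I.carrier
  rightHanded x y := Subtype.ext (A.rightHanded x.1 y.1)

/-- The inclusion of a `≤`-ideal. -/
def idealIncl (A : RSkewAlg.{u}) (I : LeIdeal A) : idealObj A I ⟶ A :=
  SkewHom.mk Subtype.val rfl (fun _ _ => rfl) (fun _ _ => rfl) (fun _ _ => rfl) (fun _ _ => rfl)

/-- The homomorphisms that are, up to an isomorphism of the source, inclusions of `≤`-ideals. -/
def leIdealInclusions : MorphismProperty RSkewAlg.{u} := fun A' A f =>
  ∃ (I : LeIdeal A) (k : A' ≅ idealObj A I), f = k.hom ≫ idealIncl A I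

theorem comp_toFun {A B C : RSkewAlg.{u}} (f : A ⟶ B) (g : B ⟶ C) (x : A) :
    SkewHom.toFun (f ≫ g) x = SkewHom.toFun g (SkewHom.toFun f x) := rfl

theorem id_toFun (A : RSkewAlg.{u}) (x : A) : SkewHom.toFun (𝟙 A) x = x := rfl

theorem NatLe.map {A B : Type u} [SkewAlgebra A] [SkewAlgebra B] (f : SkewHom A B) {x y : A}
    (h : NatLe x y) : NatLe (f.toFun x) (f.toFun y) :=
  ⟨by rw [← f.map_meet, h.1], by rw [← f.map_meet, h.2]⟩

/-- Characterization: injective homomorphisms whose image is downward closed. -/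
theorem leIdealInclusions_iff {A' A : RSkewAlg.{u}} (f : A' ⟶ A) :
    leIdealInclusions f ↔ Function.Injective (SkewHom.toFun f) ∧
      ∀ (x : A) (y : A'), NatLe x (SkewHom.toFun f y) → ∃ z, SkewHom.toFun f z = x := by
  constructor
  · rintro ⟨I, k, rfl⟩
    have hl : ∀ x, SkewHom.toFun k.inv (SkewHom.toFun k.hom x) = x := fun x => by
      rw [← comp_toFun, k.hom_inv_id, id_toFun]
    have hr : ∀ x, SkewHom.toFun k.hom (SkewHom.toFun k.inv x) = x := fun x => by
      rw [← comp_toFun, k.inv_hom_id, id_toFun]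
    constructor
    · intro x y hxy
      have : SkewHom.toFun k.hom x = SkewHom.toFun k.hom y := Subtype.ext hxy
      rw [← hl x, this, hl]
    · intro x y hxy
      refine ⟨SkewHom.toFun k.inv ⟨x, I.lower hxy (SkewHom.toFun k.hom y).2⟩, ?_⟩
      exact congrArg Subtype.val (hr ⟨x, I.lower hxy (SkewHom.toFun k.hom y).2⟩)
  · rintro ⟨hi, hl⟩
    let I : LeIdeal A :=
      { carrier := Set.range (SkewHom.toFun f)
        zero_mem := ⟨0, SkewHom.map_zero f⟩
        join_mem := by
          rintro _ _ ⟨x, rfl⟩ ⟨y, rfl⟩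
          exact ⟨x ⊻ₛ y, SkewHom.map_join f x y⟩
        lower := by
          rintro x _ h ⟨y, rfl⟩
          exact hl x y h }
    let e : A' ≃ I.carrier := Equiv.ofInjective _ hi
    have hs : ∀ x, SkewHom.toFun f (e.symm x) = x.1 := fun x =>
      congrArg Subtype.val (e.apply_symm_apply x)
    let k : A' ≅ idealObj A I :=
      { hom := SkewHom.mk e (Subtype.ext (SkewHom.map_zero f))
          (fun x y => Subtype.ext (SkewHom.map_meet f x y))
          (fun x y => Subtype.ext (SkewHom.map_join f x y))
          (fun x y => Subtype.ext (SkewHom.map_diff f x y))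
          (fun x y => Subtype.ext (SkewHom.map_inter f x y))
        inv := SkewHom.mk e.symm
          (e.symm_apply_eq.2 (Subtype.ext (SkewHom.map_zero f).symm))
          (fun x y => e.symm_apply_eq.2 (Subtype.ext
            ((SkewHom.map_meet f _ _).trans (congrArg₂ (· ⊼ₛ ·) (hs x) (hs y))).symm))
          (fun x y => e.symm_apply_eq.2 (Subtype.ext
            ((SkewHom.map_join f _ _).trans (congrArg₂ (· ⊻ₛ ·) (hs x) (hs y))).symm))
          (fun x y => e.symm_apply_eq.2 (Subtype.ext
            ((SkewHom.map_diff f _ _).trans (congrArg₂ (· ∖ₛ ·) (hs x) (hs y))).symm))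
          (fun x y => e.symm_apply_eq.2 (Subtype.ext
            ((SkewHom.map_inter f _ _).trans (congrArg₂ (· ∩ₛ ·) (hs x) (hs y))).symm))
        hom_inv_id := SkewHom.ext (funext fun x => e.symm_apply_apply x)
        inv_hom_id := SkewHom.ext (funext fun x => e.apply_symm_apply x) }
    exact ⟨I, k, rfl⟩

instance : leIdealInclusions.{u}.IsMultiplicative where
  id_mem A := (leIdealInclusions_iff _).2 ⟨fun _ _ h => h, fun x _ _ => ⟨x, rfl⟩⟩
  comp_mem f g hf hg := by
    rw [leIdealInclusions_iff] at *
    refine ⟨hg.1.comp hf.1, fun x y h => ?_⟩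
    obtain ⟨z, rfl⟩ := hg.2 x _ h
    have h' : NatLe z (SkewHom.toFun f y) :=
      ⟨hg.1 (by rw [SkewHom.map_meet g]; exact h.1), hg.1 (by rw [SkewHom.map_meet g]; exact h.2)⟩
    obtain ⟨w, rfl⟩ := hf.2 z y h'
    exact ⟨w, rfl⟩

/-! ## Skew Boolean spaces -/

/-- Boolean spaces: locally compact zero-dimensional Hausdorff spaces. -/
def IsBooleanSpace (X : Type u) [TopologicalSpace X] : Prop :=
  LocallyCompactSpace X ∧ T2Space X ∧ IsTopologicalBasis {s : Set X | IsClopen s}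

/-- `p` is a skew Boolean space: a surjective étale map between Boolean spaces. -/
def IsSkewBooleanSpace {E B : Type u} [TopologicalSpace E] [TopologicalSpace B] (p : E → B) :
    Prop :=
  IsBooleanSpace E ∧ IsBooleanSpace B ∧ IsLocalHomeomorph p ∧ Function.Surjective p

/-- A proper continuous partial map with open domain. (`PContinuous` says that inverse images of
open sets are open, which for a partial map means that its domain is open and that it is
continuous on its domain.) -/
def IsProperPartial {X Y : Type u} [TopologicalSpace X] [TopologicalSpace Y] (f : X →. Y) : Prop :=
  PContinuous f ∧ ∀ K : Set Y, IsCompact K → IsCompact (f.preimage K)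

/-- `(g, h)` is a morphism from `p` to `p'`. The square commutes: `g` maps its domain
over the domain of `h`, and `p' (g e) = h (p e)` there. Moreover `g` maps
`E_x ∩ dom g` bijectively onto `E'_{h x}` for all `x ∈ dom h`. -/
structure IsSkewMorphism {E B E' B' : Type u} [TopologicalSpace E] [TopologicalSpace B]
    [TopologicalSpace E'] [TopologicalSpace B'] (p : E → B) (p' : E' → B')
    (g : E →. E') (h : B →. B') : Prop where
  proper_top : IsProperPartial g
  proper_base : IsProperPartial h
  image_dom : p '' g.Dom = h.Dom
  comm : ∀ e e', e' ∈ g e → p' e' ∈ h (p e)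
  fiber : ∀ x e', p' e' ∈ h x → ∃! e, p e = x ∧ e' ∈ g e

/-- Bundled skew Boolean spaces. -/
structure SkewBoolSp : Type (u + 1) where
  E : Type u
  B : Type u
  [topE : TopologicalSpace E]
  [topB : TopologicalSpace B]
  p : E → B
  isSkew : IsSkewBooleanSpace p

instance (X : SkewBoolSp.{u}) : TopologicalSpace X.E := X.topE
instance (X : SkewBoolSp.{u}) : TopologicalSpace X.B := X.topB

/-- Morphisms of skew Boolean spaces. -/
@[ext]
structure SpHom (X Y : SkewBoolSp.{u}) where
  top : X.E →. Y.E
  base : X.B →. Y.B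
  isMor : IsSkewMorphism X.p Y.p top base

theorem mem_comp {α β γ : Type u} (f : β →. γ) (g : α →. β) (x : α) (z : γ) :
    z ∈ f.comp g x ↔ ∃ y, y ∈ g x ∧ z ∈ f y := by
  rw [PFun.comp_apply]; exact Part.mem_bind_iff

theorem IsProperPartial.comp {X Y Z : Type u} [TopologicalSpace X] [TopologicalSpace Y]
    [TopologicalSpace Z] {f : Y →. Z} {g : X →. Y} (hf : IsProperPartial f)
    (hg : IsProperPartial g) : IsProperPartial (f.comp g) := by
  constructor
  · intro s hs
    rw [PFun.preimage_comp]
    exact hg.1 _ (hf.1 _ hs)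
  · intro K hK
    rw [PFun.preimage_comp]
    exact hg.2 _ (hf.2 _ hK)

theorem mem_id {α : Type u} (x y : α) : y ∈ PFun.id α x ↔ y = x := Part.mem_some_iff

theorem isProperPartial_id (X : Type u) [TopologicalSpace X] : IsProperPartial (PFun.id X) := by
  have h : ∀ s, (PFun.id X).preimage s = s := fun s => by
    ext x; simp [PFun.mem_preimage]
  exact ⟨fun s hs => by rwa [h], fun K hK => by rwa [h]⟩

theorem IsSkewMorphism.id {E B : Type u} [TopologicalSpace E] [TopologicalSpace B] {p : E → B}
    (hp : Function.Surjective p) : IsSkewMorphism p p (PFun.id E) (PFun.id B) where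
  proper_top := isProperPartial_id E
  proper_base := isProperPartial_id B
  image_dom := by
    ext x; simp [PFun.mem_dom, hp x]
  comm e e' h := (mem_id _ _).2 (congrArg p ((mem_id _ _).1 h))
  fiber x e' h :=
    ⟨e', ⟨(mem_id _ _).1 h, (mem_id _ _).2 rfl⟩, fun y hy => ((mem_id _ _).1 hy.2).symm⟩

theorem IsSkewMorphism.comp {E B E' B' E'' B'' : Type u} [TopologicalSpace E]
    [TopologicalSpace B] [TopologicalSpace E'] [TopologicalSpace B'] [TopologicalSpace E'']
    [TopologicalSpace B''] {p : E → B} {p' : E' → B'} {p'' : E'' → B''}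
    (hp'' : Function.Surjective p'')
    {g : E →. E'} {h : B →. B'} {g' : E' →. E''} {h' : B' →. B''}
    (m : IsSkewMorphism p p' g h) (m' : IsSkewMorphism p' p'' g' h') :
    IsSkewMorphism p p'' (g'.comp g) (h'.comp h) := by
  have comm : ∀ e e'', e'' ∈ g'.comp g e → p'' e'' ∈ h'.comp h (p e) := by
    intro e e'' he
    obtain ⟨e', h1, h2⟩ := (mem_comp _ _ _ _).1 he
    exact (mem_comp _ _ _ _).2 ⟨p' e', m.comm _ _ h1, m'.comm _ _ h2⟩
  have fiber : ∀ x e'', p'' e'' ∈ h'.comp h x → ∃! e, p e = x ∧ e'' ∈ g'.comp g e := by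
    intro x e'' he
    obtain ⟨y, h1, h2⟩ := (mem_comp _ _ _ _).1 he
    obtain ⟨e', ⟨rfl, he'⟩, hu'⟩ := m'.fiber y e'' h2
    obtain ⟨e, ⟨rfl, hee⟩, hu⟩ := m.fiber x e' h1
    refine ⟨e, ⟨rfl, (mem_comp _ _ _ _).2 ⟨e', hee, he'⟩⟩, ?_⟩
    rintro a ⟨ha, ha'⟩
    obtain ⟨b, hb, hb'⟩ := (mem_comp _ _ _ _).1 ha'
    have h3 := m.comm _ _ hb
    rw [ha] at h3
    have : b = e' := hu' b ⟨Part.mem_unique h3 h1, hb'⟩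
    exact hu a ⟨ha, this ▸ hb⟩
  refine ⟨m'.proper_top.comp m.proper_top, m'.proper_base.comp m.proper_base, ?_, comm, fiber⟩
  ext x
  constructor
  · rintro ⟨e, he, rfl⟩
    obtain ⟨e'', he⟩ := (PFun.mem_dom _ _).1 he
    exact (PFun.mem_dom _ _).2 ⟨_, comm _ _ he⟩
  · intro hx
    obtain ⟨y, hy⟩ := (PFun.mem_dom _ _).1 hx
    obtain ⟨e'', rfl⟩ := hp'' y
    obtain ⟨e, ⟨h1, h2⟩, -⟩ := fiber x e'' hy
    exact ⟨e, (PFun.mem_dom _ _).2 ⟨_, h2⟩, h1⟩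

/-- The category of skew Boolean spaces. -/
instance : Category.{u} SkewBoolSp.{u} where
  Hom := SpHom
  id X := ⟨PFun.id X.E, PFun.id X.B, IsSkewMorphism.id X.isSkew.2.2.2⟩
  comp {_ _ Z} f g :=
    ⟨g.top.comp f.top, g.base.comp f.base, IsSkewMorphism.comp Z.isSkew.2.2.2 f.isMor g.isMor⟩
  id_comp _ := SpHom.ext (PFun.comp_id _) (PFun.comp_id _)
  comp_id _ := SpHom.ext (PFun.id_comp _) (PFun.id_comp _)
  assoc _ _ _ := SpHom.ext (PFun.comp_assoc _ _ _).symm (PFun.comp_assoc _ _ _).symm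

/-! ## Partial identities with open domains -/

theorem IsBooleanSpace.opens {X : Type u} [TopologicalSpace X] (h : IsBooleanSpace X)
    {U : Set X} (hU : IsOpen U) : IsBooleanSpace U := by
  obtain ⟨h1, h2, h3⟩ := h
  refine ⟨hU.locallyCompactSpace, inferInstance, ?_⟩
  refine isTopologicalBasis_of_isOpen_of_nhds (fun s hs => hs.2) ?_
  intro x s hx hs
  obtain ⟨t, ht, rfl⟩ := isOpen_induced_iff.1 hs
  obtain ⟨v, hv, hxv, hvt⟩ := h3.exists_subset_of_mem_open (show x.1 ∈ t from hx) ht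
  exact ⟨Subtype.val ⁻¹' v, hv.preimage continuous_subtype_val, hxv, fun y hy => hvt hy⟩

/-- The restriction `p|_U : U → p(U)` of a map to a subset of its source. -/
def restrictMap {E B : Type u} (p : E → B) (U : Set E) : U → p '' U :=
  fun e => ⟨p e.1, e.1, e.2, rfl⟩

theorem isSkewBooleanSpace_restrict {E B : Type u} [TopologicalSpace E] [TopologicalSpace B]
    {p : E → B} (hp : IsSkewBooleanSpace p) {U : Set E} (hU : IsOpen U) :
    IsSkewBooleanSpace (restrictMap p U) := by
  obtain ⟨h1, h2, h3, h4⟩ := hp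
  have hV : IsOpen (p '' U) := h3.isOpenMap _ hU
  refine ⟨h1.opens hU, h2.opens hV, ?_, ?_⟩
  · refine IsLocalHomeomorph.of_comp (g := (Subtype.val : p '' U → B)) ?_
      hV.isOpenEmbedding_subtypeVal.isLocalHomeomorph ?_
    · exact h3.comp hU.isOpenEmbedding_subtypeVal.isLocalHomeomorph
    · exact (h3.continuous.comp continuous_subtype_val).subtype_mk _
  · rintro ⟨_, e, he, rfl⟩
    exact ⟨⟨e, he⟩, rfl⟩

/-- The skew Boolean space `p|_U : U → p(U)`. -/
def restrictObj (X : SkewBoolSp.{u}) (U : Opens X.E) : SkewBoolSp.{u} where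
  E := (U : Set X.E)
  B := (X.p '' (U : Set X.E) : Set X.B)
  p := restrictMap X.p (U : Set X.E)
  isSkew := isSkewBooleanSpace_restrict X.isSkew U.isOpen

/-- The partial identity `X ⇀ U`, with domain `U`. -/
def partialIdMap {X : Type u} (U : Set X) : X →. U := fun x => ⟨x ∈ U, fun h => ⟨x, h⟩⟩

theorem mem_partialIdMap {X : Type u} (U : Set X) (x : X) (y : U) :
    y ∈ partialIdMap U x ↔ y.1 = x := by
  constructor
  · rintro ⟨h, rfl⟩; rfl
  · rintro rfl; exact ⟨y.2, rfl⟩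

theorem preimage_partialIdMap {X : Type u} (U : Set X) (s : Set U) :
    (partialIdMap U).preimage s = Subtype.val '' s := by
  ext x
  simp only [PFun.mem_preimage, mem_partialIdMap, Set.mem_image]

theorem isProperPartial_partialIdMap {X : Type u} [TopologicalSpace X] {U : Set X}
    (hU : IsOpen U) : IsProperPartial (partialIdMap U) := by
  refine ⟨fun s hs => ?_, fun K hK => ?_⟩
  · rw [preimage_partialIdMap]; exact hU.isOpenMap_subtype_val _ hs
  · rw [preimage_partialIdMap]; exact hK.image continuous_subtype_val

/-- The partial identity on a skew Boolean space `p : E → B` determined by an open `U ⊆ E`: the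
pair of partial identities `E ⇀ U` and `B ⇀ p(U)`, as a morphism from `p` to `p|_U`. -/
def partialId (X : SkewBoolSp.{u}) (U : Opens X.E) : X ⟶ restrictObj X U :=
  SpHom.mk (X := X) (Y := restrictObj X U)
    (partialIdMap (U : Set X.E)) (partialIdMap (X.p '' (U : Set X.E)))
    { proper_top := isProperPartial_partialIdMap U.isOpen
      proper_base := isProperPartial_partialIdMap (X.isSkew.2.2.1.isOpenMap _ U.isOpen)
      image_dom := rfl
      comm := by
        intro e e' h
        exact (mem_partialIdMap _ _ _).2 (congrArg X.p ((mem_partialIdMap _ _ _).1 h))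
      fiber := by
        intro x e' h
        have h' := (mem_partialIdMap _ _ _).1 h
        exact ⟨e'.1, ⟨h', (mem_partialIdMap _ _ _).2 rfl⟩,
          fun y hy => ((mem_partialIdMap _ _ _).1 hy.2).symm⟩ }

/-- The morphisms that are, up to an isomorphism of the target, partial identities with open
domains. -/
def partialIdentities : MorphismProperty SkewBoolSp.{u} := fun X Y m =>
  ∃ (U : Opens X.E) (k : restrictObj X U ≅ Y), m = partialId X U ≫ k.hom

theorem mem_comp_top {X Y Z : SkewBoolSp.{u}} (m : X ⟶ Y) (n : Y ⟶ Z) (x : X.E) (z : Z.E) :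
    z ∈ SpHom.top (m ≫ n) x ↔ ∃ y, y ∈ SpHom.top m x ∧ z ∈ SpHom.top n y := mem_comp _ _ _ _

theorem mem_comp_base {X Y Z : SkewBoolSp.{u}} (m : X ⟶ Y) (n : Y ⟶ Z) (x : X.B) (z : Z.B) :
    z ∈ SpHom.base (m ≫ n) x ↔ ∃ y, y ∈ SpHom.base m x ∧ z ∈ SpHom.base n y := mem_comp _ _ _ _

/-- The partial map `f` restricts to a homeomorphism from its domain onto the whole target. -/
def IsPartialHomeo {X Y : Type u} [TopologicalSpace X] [TopologicalSpace Y] (f : X →. Y) : Prop :=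
  (∀ y, ∃! x, y ∈ f x) ∧ ∀ O : Set X, IsOpen O → IsOpen (f.image O)

theorem IsPartialHomeo.comp {X Y Z : Type u} [TopologicalSpace X] [TopologicalSpace Y]
    [TopologicalSpace Z] {f : Y →. Z} {g : X →. Y} (hf : IsPartialHomeo f)
    (hg : IsPartialHomeo g) : IsPartialHomeo (f.comp g) := by
  refine ⟨fun z => ?_, fun O hO => ?_⟩
  · obtain ⟨y, hy, hyu⟩ := hf.1 z
    obtain ⟨x, hx, hxu⟩ := hg.1 y
    refine ⟨x, (mem_comp _ _ _ _).2 ⟨y, hx, hy⟩, fun x' hx' => ?_⟩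
    obtain ⟨y', h1, h2⟩ := (mem_comp _ _ _ _).1 hx'
    exact hxu _ (hyu _ h2 ▸ h1)
  · have : (f.comp g).image O = f.image (g.image O) := by
      ext z
      simp only [PFun.mem_image, mem_comp]
      exact ⟨fun ⟨x, h1, y, h2, h3⟩ => ⟨y, ⟨x, h1, h2⟩, h3⟩,
        fun ⟨y, ⟨x, h1, h2⟩, h3⟩ => ⟨x, h1, y, h2, h3⟩⟩
    rw [this]
    exact hf.2 _ (hg.2 _ hO)

theorem isPartialHomeo_of_inverse {X Y : Type u} [TopologicalSpace X] [TopologicalSpace Y]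
    {f : X →. Y} {g : Y →. X} (hg : PContinuous g) (h1 : g.comp f = PFun.id X)
    (h2 : f.comp g = PFun.id Y) : IsPartialHomeo f := by
  have key : ∀ x y, y ∈ f x ↔ x ∈ g y := by
    intro x y
    constructor
    · intro h
      have hx : x ∈ g.comp f x := by rw [h1]; simp
      obtain ⟨y', h3, h4⟩ := (mem_comp _ _ _ _).1 hx
      exact Part.mem_unique h3 h ▸ h4
    · intro h
      have hy : y ∈ f.comp g y := by rw [h2]; simp
      obtain ⟨x', h3, h4⟩ := (mem_comp _ _ _ _).1 hy
      exact Part.mem_unique h3 h ▸ h4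
  refine ⟨fun y => ?_, fun O hO => ?_⟩
  · have hy : y ∈ f.comp g y := by rw [h2]; simp
    obtain ⟨x, h3, h4⟩ := (mem_comp _ _ _ _).1 hy
    exact ⟨x, h4, fun x' hx' => Part.mem_unique ((key _ _).1 hx') h3⟩
  · have : f.image O = g.preimage O := by
      ext y
      simp only [PFun.mem_image, PFun.mem_preimage, key]
    rw [this]; exact hg _ hO

theorem isPartialHomeo_partialIdMap {X : Type u} [TopologicalSpace X] (U : Set X) :
    IsPartialHomeo (partialIdMap U) := by
  refine ⟨fun y => ⟨y.1, (mem_partialIdMap _ _ _).2 rfl,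
    fun x hx => ((mem_partialIdMap _ _ _).1 hx).symm⟩, fun O hO => ?_⟩
  have : (partialIdMap U).image O = Subtype.val ⁻¹' O := by
    ext y
    simp only [PFun.mem_image, mem_partialIdMap, Set.mem_preimage]
    exact ⟨fun ⟨x, h1, h2⟩ => h2 ▸ h1, fun h => ⟨_, h, rfl⟩⟩
  rw [this]; exact hO.preimage continuous_subtype_val

theorem isProperPartial_of_homeo {X Y : Type u} [TopologicalSpace X] [TopologicalSpace Y]
    {f : X →. Y} (hf : IsProperPartial f) (hh : IsPartialHomeo f) {U : Set X} (hU : U = f.Dom)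
    (hUo : IsOpen U) :
    ∃ (a : U →. Y) (b : Y →. U), IsProperPartial a ∧ IsProperPartial b ∧
      (∀ u y, y ∈ a u ↔ y ∈ f u.1) ∧ (∀ u y, u ∈ b y ↔ y ∈ f u.1) := by
  choose s hs hsu using hh.1
  have hsU : ∀ y, s y ∈ U := fun y => hU ▸ (PFun.mem_dom _ _).2 ⟨y, hs y⟩
  let a : U →. Y := fun u => f u.1
  let b : Y →. U := fun y => Part.some ⟨s y, hsU y⟩
  have hb : ∀ u y, u ∈ b y ↔ y ∈ f u.1 := by
    intro u y
    rw [show b y = Part.some ⟨s y, hsU y⟩ from rfl, Part.mem_some_iff]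
    exact ⟨fun h => h ▸ hs y, fun h => Subtype.ext (hsu _ _ h)⟩
  have ha : ∀ t, a.preimage t = Subtype.val ⁻¹' (f.preimage t) := fun t => by
    ext u; simp only [PFun.mem_preimage, Set.mem_preimage]; rfl
  have hbp : ∀ t, b.preimage t = f.image (Subtype.val '' t) := fun t => by
    ext y
    simp only [PFun.mem_preimage, PFun.mem_image, hb, Set.mem_image]
    exact ⟨fun ⟨u, h1, h2⟩ => ⟨u.1, ⟨u, h1, rfl⟩, h2⟩, fun ⟨_, ⟨u, h1, rfl⟩, h2⟩ => ⟨u, h1, h2⟩⟩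
  have hsc : Continuous fun u : U => (f u.1).get (show u.1 ∈ f.Dom from hU ▸ u.2) := by
    rw [continuous_def]
    intro t ht
    convert (hf.1 t ht).preimage (continuous_subtype_val (p := (· ∈ U))) using 1
    ext u
    simp only [PFun.mem_preimage, Set.mem_preimage]
    exact ⟨fun h => ⟨_, h, Part.get_mem _⟩, fun ⟨y, h1, h2⟩ => by
      have h3 := Part.get_eq_of_mem h2 (show u.1 ∈ f.Dom from hU ▸ u.2)
      exact (congrArg (· ∈ t) h3).mpr h1⟩
  refine ⟨a, b, ⟨fun t ht => ?_, fun K hK => ?_⟩, ⟨fun t ht => ?_, fun K hK => ?_⟩,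
    fun _ _ => Iff.rfl, hb⟩
  · rw [ha]; exact (hf.1 t ht).preimage continuous_subtype_val
  · rw [ha]
    refine Topology.IsInducing.subtypeVal.isCompact_preimage_iff ?_ |>.2 (hf.2 K hK)
    rw [Subtype.range_coe_subtype, Set.ofPred_mem_eq, hU]
    exact PFun.preimage_subset_dom _ _
  · rw [hbp]; exact hh.2 _ (hUo.isOpenMap_subtype_val _ ht)
  · have : b.preimage K = (fun u : U => (f u.1).get (show u.1 ∈ f.Dom from hU ▸ u.2)) '' K := by
      rw [hbp]
      ext y
      simp only [PFun.mem_image, Set.mem_image]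
      exact ⟨fun ⟨_, ⟨u, h1, rfl⟩, h2⟩ => ⟨u, h1, Part.get_eq_of_mem h2 _⟩,
        fun ⟨u, h1, h2⟩ => ⟨u.1, ⟨u, h1, rfl⟩, h2 ▸ Part.get_mem _⟩⟩
    rw [this]; exact hK.image hsc

/-- Characterization: both components are homeomorphisms from their domains onto the target. -/
theorem partialIdentities_iff {X Y : SkewBoolSp.{u}} (m : X ⟶ Y) :
    partialIdentities m ↔ IsPartialHomeo (SpHom.top m) ∧ IsPartialHomeo (SpHom.base m) := by
  constructor
  · rintro ⟨U, k, rfl⟩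
    have t1 : (SpHom.top k.inv).comp (SpHom.top k.hom) = PFun.id _ :=
      congrArg SpHom.top k.hom_inv_id
    have t2 : (SpHom.top k.hom).comp (SpHom.top k.inv) = PFun.id _ :=
      congrArg SpHom.top k.inv_hom_id
    have b1 : (SpHom.base k.inv).comp (SpHom.base k.hom) = PFun.id _ :=
      congrArg SpHom.base k.hom_inv_id
    have b2 : (SpHom.base k.hom).comp (SpHom.base k.inv) = PFun.id _ :=
      congrArg SpHom.base k.inv_hom_id
    exact ⟨(isPartialHomeo_of_inverse (SpHom.isMor k.inv).proper_top.1 t1 t2).comp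
        (isPartialHomeo_partialIdMap _),
      (isPartialHomeo_of_inverse (SpHom.isMor k.inv).proper_base.1 b1 b2).comp
        (isPartialHomeo_partialIdMap _)⟩
  · rintro ⟨ht, hb⟩
    have M := SpHom.isMor m
    let U : Opens X.E := ⟨(SpHom.top m).Dom, open_dom_of_pcontinuous M.proper_top.1⟩
    obtain ⟨a, a', ha, ha', hae, hae'⟩ :=
      isProperPartial_of_homeo M.proper_top ht (U := (U : Set X.E)) rfl U.isOpen
    obtain ⟨c, c', hc, hc', hce, hce'⟩ :=
      isProperPartial_of_homeo M.proper_base hb (U := X.p '' (U : Set X.E)) M.image_dom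
        (X.isSkew.2.2.1.isOpenMap _ U.isOpen)
    have totb : ∀ x : (X.p '' (U : Set X.E) : Set X.B), ∃ y, y ∈ c x := fun x => by
      obtain ⟨y, hy⟩ := (PFun.mem_dom _ _).1 (show x.1 ∈ (SpHom.base m).Dom from M.image_dom ▸ x.2)
      exact ⟨y, (hce _ _).2 hy⟩
    have tott : ∀ x : (U : Set X.E), ∃ y, y ∈ a x := fun x => by
      obtain ⟨y, hy⟩ := (PFun.mem_dom _ _).1 x.2
      exact ⟨y, (hae _ _).2 hy⟩
    have A1 : IsSkewMorphism (restrictMap X.p (U : Set X.E)) Y.p a c :=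
      { proper_top := ha
        proper_base := hc
        image_dom := by
          ext x
          constructor
          · intro _; exact (PFun.mem_dom _ _).2 (totb x)
          · intro _
            obtain ⟨e, rfl⟩ := (isSkewBooleanSpace_restrict X.isSkew U.isOpen).2.2.2 x
            exact ⟨e, (PFun.mem_dom _ _).2 (tott e), rfl⟩
        comm := fun e e' h => (hce _ _).2 (M.comm _ _ ((hae _ _).1 h))
        fiber := by
          intro x e' h
          obtain ⟨e, ⟨h1, h2⟩, h3⟩ := M.fiber x.1 e' ((hce _ _).1 h)
          refine ⟨⟨e, (PFun.mem_dom _ _).2 ⟨_, h2⟩⟩, ⟨Subtype.ext h1, (hae _ _).2 h2⟩, ?_⟩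
          rintro w ⟨hw, hw'⟩
          exact Subtype.ext (h3 w.1 ⟨congrArg Subtype.val hw, (hae _ _).1 hw'⟩) }
    have A2 : IsSkewMorphism Y.p (restrictMap X.p (U : Set X.E)) a' c' :=
      { proper_top := ha'
        proper_base := hc'
        image_dom := by
          ext y
          constructor
          · intro _
            obtain ⟨x, hx, -⟩ := hb.1 y
            exact (PFun.mem_dom _ _).2 ⟨⟨x, M.image_dom ▸ (PFun.mem_dom _ _).2 ⟨y, hx⟩⟩,
              (hce' _ _).2 hx⟩
          · intro _
            obtain ⟨e, rfl⟩ := Y.isSkew.2.2.2 y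
            obtain ⟨x, hx, -⟩ := ht.1 e
            exact ⟨e, (PFun.mem_dom _ _).2 ⟨⟨x, (PFun.mem_dom _ _).2 ⟨e, hx⟩⟩,
              (hae' _ _).2 hx⟩, rfl⟩
        comm := fun e e' h => (hce' _ _).2 (M.comm _ _ ((hae' _ _).1 h))
        fiber := by
          intro y e' h
          obtain ⟨z, hz⟩ := tott e'
          refine ⟨z, ⟨?_, (hae' _ _).2 ((hae _ _).1 hz)⟩, ?_⟩
          · exact Part.mem_unique (M.comm _ _ ((hae _ _).1 hz)) ((hce' _ _).1 h)
          · rintro w ⟨-, hw⟩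
            exact Part.mem_unique ((hae' _ _).1 hw) ((hae _ _).1 hz) }
    refine ⟨U, ⟨SpHom.mk (X := restrictObj X U) (Y := Y) a c A1,
      SpHom.mk (X := Y) (Y := restrictObj X U) a' c' A2, ?_, ?_⟩, ?_⟩
    · refine SpHom.ext (PFun.ext fun x z => ?_) (PFun.ext fun x z => ?_)
      · refine (mem_comp _ _ _ _).trans ?_
        change _ ↔ z ∈ Part.some x
        rw [Part.mem_some_iff]
        constructor
        · rintro ⟨y, h1, h2⟩
          exact Subtype.ext ((ht.1 y).unique ((hae' _ _).1 h2) ((hae _ _).1 h1))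
        · rintro rfl
          obtain ⟨y, hy⟩ := tott z
          exact ⟨y, hy, (hae' _ _).2 ((hae _ _).1 hy)⟩
      · refine (mem_comp _ _ _ _).trans ?_
        change _ ↔ z ∈ Part.some x
        rw [Part.mem_some_iff]
        constructor
        · rintro ⟨y, h1, h2⟩
          exact Subtype.ext ((hb.1 y).unique ((hce' _ _).1 h2) ((hce _ _).1 h1))
        · rintro rfl
          obtain ⟨y, hy⟩ := totb z
          exact ⟨y, hy, (hce' _ _).2 ((hce _ _).1 hy)⟩
    · refine SpHom.ext (PFun.ext fun x z => ?_) (PFun.ext fun x z => ?_)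
      · refine (mem_comp _ _ _ _).trans ?_
        change _ ↔ z ∈ Part.some x
        rw [Part.mem_some_iff]
        constructor
        · rintro ⟨y, h1, h2⟩
          exact Part.mem_unique ((hae _ _).1 h2) ((hae' _ _).1 h1)
        · rintro rfl
          obtain ⟨x, hx, -⟩ := ht.1 z
          exact ⟨⟨x, (PFun.mem_dom _ _).2 ⟨z, hx⟩⟩, (hae' _ _).2 hx, (hae _ _).2 hx⟩
      · refine (mem_comp _ _ _ _).trans ?_
        change _ ↔ z ∈ Part.some x
        rw [Part.mem_some_iff]
        constructor
        · rintro ⟨y, h1, h2⟩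
          exact Part.mem_unique ((hce _ _).1 h2) ((hce' _ _).1 h1)
        · rintro rfl
          obtain ⟨x, hx, -⟩ := hb.1 z
          exact ⟨⟨x, M.image_dom ▸ (PFun.mem_dom _ _).2 ⟨z, hx⟩⟩, (hce' _ _).2 hx, (hce _ _).2 hx⟩
    · refine SpHom.ext (PFun.ext fun x z => ?_) (PFun.ext fun x z => ?_)
      · refine Iff.trans ?_ (mem_comp _ _ _ _).symm
        constructor
        · intro h
          exact ⟨⟨x, (PFun.mem_dom _ _).2 ⟨z, h⟩⟩, (mem_partialIdMap _ _ _).2 rfl, (hae _ _).2 h⟩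
        · rintro ⟨y, h1, h2⟩
          rw [← (mem_partialIdMap _ _ _).1 h1]
          exact (hae _ _).1 h2
      · refine Iff.trans ?_ (mem_comp _ _ _ _).symm
        constructor
        · intro h
          exact ⟨⟨x, M.image_dom ▸ (PFun.mem_dom _ _).2 ⟨z, h⟩⟩, (mem_partialIdMap _ _ _).2 rfl,
            (hce _ _).2 h⟩
        · rintro ⟨y, h1, h2⟩
          rw [← (mem_partialIdMap _ _ _).1 h1]
          exact (hce _ _).1 h2

theorem isPartialHomeo_id (X : Type u) [TopologicalSpace X] : IsPartialHomeo (PFun.id X) :=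
  isPartialHomeo_of_inverse (isProperPartial_id X).1 (PFun.comp_id _) (PFun.comp_id _)

instance : partialIdentities.{u}.IsMultiplicative where
  id_mem X := (partialIdentities_iff _).2 ⟨isPartialHomeo_id _, isPartialHomeo_id _⟩
  comp_mem f g hf hg := by
    rw [partialIdentities_iff] at *
    exact ⟨hg.1.comp hf.1, hg.2.comp hf.2⟩

/-! ## From spaces to algebras: the algebra of copen sections -/

/-- The saturation `σ_p(S) = p⁻¹(p(S))`. -/
def sat {E B : Type u} (p : E → B) (S : Set E) : Set E := p ⁻¹' (p '' S)

theorem mem_sat {E B : Type u} (p : E → B) (S : Set E) (e : E) :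
    e ∈ sat p S ↔ ∃ s ∈ S, p s = p e := Iff.rfl

theorem subset_sat {E B : Type u} (p : E → B) (S : Set E) {e : E} (h : e ∈ S) : e ∈ sat p S :=
  ⟨e, h, rfl⟩

theorem sat_meet {E B : Type u} (p : E → B) (S R : Set E) :
    sat p (sat p S ∩ R) = sat p S ∩ sat p R := by
  ext e
  simp only [Set.mem_inter_iff, mem_sat]
  constructor
  · rintro ⟨s, ⟨⟨t, ht, h1⟩, hs⟩, h2⟩
    exact ⟨⟨t, ht, h1.trans h2⟩, s, hs, h2⟩
  · rintro ⟨⟨t, ht, h1⟩, s, hs, h2⟩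
    exact ⟨s, ⟨⟨t, ht, h1.trans h2.symm⟩, hs⟩, h2⟩

theorem sat_diff {E B : Type u} (p : E → B) (S R : Set E) :
    sat p (S \ sat p R) = sat p S \ sat p R := by
  ext e
  simp only [Set.mem_sdiff, mem_sat]
  constructor
  · rintro ⟨s, ⟨hs, h1⟩, h2⟩
    exact ⟨⟨s, hs, h2⟩, fun ⟨t, ht, h3⟩ => h1 ⟨t, ht, h3.trans h2.symm⟩⟩
  · rintro ⟨⟨s, hs, h2⟩, h1⟩
    exact ⟨s, ⟨hs, fun ⟨t, ht, h3⟩ => h1 ⟨t, ht, h3.trans h2⟩⟩, h2⟩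

theorem sat_union {E B : Type u} (p : E → B) (S R : Set E) :
    sat p (S ∪ R) = sat p S ∪ sat p R := by
  simp only [sat, Set.image_union, Set.preimage_union]

theorem sat_join {E B : Type u} (p : E → B) (S R : Set E) :
    sat p (S ∪ (R \ sat p S)) = sat p S ∪ sat p R := by
  rw [sat_union, sat_diff, Set.union_sdiff_self]

/-- Copen sections of `p`, viewed as the compact open subsets of the total space on which `p` is
injective. -/
@[ext]
structure CopenSection (X : SkewBoolSp.{u}) : Type u where
  carrier : Set X.E
  isOpen : IsOpen carrier
  isCompact : IsCompact carrier
  injOn : Set.InjOn X.p carrier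

theorem isClopen_sat {X : SkewBoolSp.{u}} (S : CopenSection X) : IsClopen (sat X.p S.carrier) := by
  have hc : Continuous X.p := X.isSkew.2.2.1.continuous
  have : T2Space X.B := X.isSkew.2.1.2.1
  exact ⟨((S.isCompact.image hc).isClosed).preimage hc,
    (X.isSkew.2.2.1.isOpenMap _ S.isOpen).preimage hc⟩

section

variable {X : SkewBoolSp.{u}}

/-- `S ∧ R = σ(S) ∩ R`. -/
def secMeet (S R : CopenSection X) : CopenSection X where
  carrier := sat X.p S.carrier ∩ R.carrier
  isOpen := (isClopen_sat S).isOpen.inter R.isOpen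
  isCompact := R.isCompact.inter_left (isClopen_sat S).isClosed
  injOn := R.injOn.mono Set.inter_subset_right

/-- `S \ R = S - σ(R)`. -/
def secDiff (S R : CopenSection X) : CopenSection X where
  carrier := S.carrier \ sat X.p R.carrier
  isOpen := S.isOpen.sdiff (isClopen_sat R).isClosed
  isCompact := S.isCompact.diff (isClopen_sat R).isOpen
  injOn := S.injOn.mono Set.sdiff_subset

/-- `S ∨ R = S ∪ (R - σ(S))`. -/
def secJoin (S R : CopenSection X) : CopenSection X where
  carrier := S.carrier ∪ (R.carrier \ sat X.p S.carrier)
  isOpen := S.isOpen.union (secDiff R S).isOpen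
  isCompact := S.isCompact.union (secDiff R S).isCompact
  injOn := by
    rintro a (ha | ha) b (hb | hb) hab
    · exact S.injOn ha hb hab
    · exact absurd ⟨a, ha, hab⟩ hb.2
    · exact absurd ⟨b, hb, hab.symm⟩ ha.2
    · exact R.injOn ha.1 hb.1 hab

/-- `S ∩ R`, the intersection. -/
def secInter (S R : CopenSection X) : CopenSection X where
  carrier := S.carrier ∩ R.carrier
  isOpen := S.isOpen.inter R.isOpen
  isCompact :=
    have : T2Space X.E := X.isSkew.1.2.1
    S.isCompact.inter R.isCompact
  injOn := S.injOn.mono Set.inter_subset_left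

instance : SkewLattice (CopenSection X) where
  meet := secMeet
  join := secJoin
  meet_self S := by
    ext e; simp only [secMeet, Set.mem_inter_iff]
    have := @subset_sat _ _ X.p S.carrier e
    tauto
  join_self S := by
    ext e; simp only [secJoin, Set.mem_union, Set.mem_sdiff]
    have := @subset_sat _ _ X.p S.carrier e
    tauto
  meet_assoc S R T := by
    ext e; simp only [secMeet, sat_meet, Set.mem_inter_iff]
    tauto
  join_assoc S R T := by
    ext e; simp only [secJoin, sat_join, Set.mem_union, Set.mem_sdiff]
    tauto
  meet_join_absorb S R := by
    ext e; simp only [secMeet, secJoin, Set.mem_inter_iff, Set.mem_union, Set.mem_sdiff]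
    have := @subset_sat _ _ X.p S.carrier e
    tauto
  join_meet_absorb S R := by
    ext e; simp only [secMeet, secJoin, sat_join, Set.mem_inter_iff, Set.mem_union]
    have := @subset_sat _ _ X.p S.carrier e
    tauto
  join_meet_absorb' S R := by
    ext e; simp only [secMeet, secJoin, Set.mem_inter_iff, Set.mem_union, Set.mem_sdiff]
    tauto
  meet_join_absorb' S R := by
    ext e
    simp only [secMeet, secJoin, sat_meet, Set.mem_inter_iff, Set.mem_union, Set.mem_sdiff]
    have := @subset_sat _ _ X.p S.carrier e
    tauto

/-- The natural partial order on copen sections is inclusion. -/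
theorem natLe_iff (S R : CopenSection X) : NatLe S R ↔ S.carrier ⊆ R.carrier := by
  constructor
  · rintro ⟨h, -⟩ e he
    have : e ∈ (secMeet S R).carrier := (congrArg CopenSection.carrier h).symm ▸ he
    exact this.2
  · intro h
    constructor
    · ext e
      constructor
      · rintro ⟨⟨s, hs, h1⟩, he⟩
        exact R.injOn (h hs) he h1 ▸ hs
      · exact fun he => ⟨subset_sat _ _ he, h he⟩
    · ext e
      exact ⟨fun he => he.2, fun he => ⟨subset_sat _ _ (h he), he⟩⟩

instance : SkewAlgebra (CopenSection X) where
  zero := ⟨∅, isOpen_empty, isCompact_empty, Set.injOn_empty _⟩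
  diff := secDiff
  inter := secInter
  meet_join_distrib S R T := by
    ext e
    simp only [SkewLattice.meet, SkewLattice.join, secMeet, secJoin, sat_meet, Set.mem_inter_iff,
      Set.mem_union, Set.mem_sdiff]
    have := @subset_sat _ _ X.p S.carrier e
    tauto
  join_meet_distrib S R T := by
    ext e
    simp only [SkewLattice.meet, SkewLattice.join, secMeet, secJoin, sat_meet, sat_join,
      Set.mem_inter_iff, Set.mem_union, Set.mem_sdiff]
    have := @subset_sat _ _ X.p S.carrier e
    tauto
  zero_join S := by
    ext e
    change e ∈ ∅ ∪ (S.carrier \ sat X.p ∅) ↔ _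
    simp [sat]
  join_zero S := by
    ext e
    change e ∈ S.carrier ∪ (∅ \ sat X.p S.carrier) ↔ _
    simp
  diff_meet S R := by
    ext e
    change _ ↔ e ∈ (∅ : Set X.E)
    simp only [SkewLattice.meet, secMeet, secDiff, sat_diff, sat_meet, Set.mem_inter_iff,
      Set.mem_sdiff, Set.mem_empty_iff_false]
    tauto
  diff_join S R := by
    ext e
    simp only [SkewLattice.meet, SkewLattice.join, secMeet, secJoin, secDiff, sat_diff, sat_meet,
      Set.mem_inter_iff, Set.mem_union, Set.mem_sdiff]
    have := @subset_sat _ _ X.p S.carrier e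
    tauto
  inter_le_left S R := (natLe_iff _ _).2 Set.inter_subset_left
  inter_le_right S R := (natLe_iff _ _).2 Set.inter_subset_right
  le_inter S R T h1 h2 :=
    (natLe_iff _ _).2 (Set.subset_inter ((natLe_iff _ _).1 h1) ((natLe_iff _ _).1 h2))

end

/-- The right-handed skew algebra of copen sections of a skew Boolean space. -/
def sectionAlg (X : SkewBoolSp.{u}) : RSkewAlg.{u} where
  carrier := CopenSection X
  rightHanded S R := by
    ext e
    simp only [SkewLattice.meet, secMeet, sat_meet, Set.mem_inter_iff]
    have := @subset_sat _ _ X.p S.carrier e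
    tauto

/-- The inverse image of a copen section under a morphism. -/
def secPreimage {X Y : SkewBoolSp.{u}} (m : SpHom X Y) (S : CopenSection Y) : CopenSection X where
  carrier := m.top.preimage S.carrier
  isOpen := m.isMor.proper_top.1 _ S.isOpen
  isCompact := m.isMor.proper_top.2 _ S.isCompact
  injOn := by
    rintro a ⟨a', ha, ha'⟩ b ⟨b', hb, hb'⟩ hab
    rw [PFun.graph'] at *
    have h1 := m.isMor.comm _ _ ha'
    have h2 := m.isMor.comm _ _ hb'
    rw [hab] at h1
    have h3 : a' = b' := S.injOn ha hb (Part.mem_unique h1 h2)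
    subst h3
    exact (m.isMor.fiber _ _ h2).unique ⟨hab, ha'⟩ ⟨rfl, hb'⟩

/-- Inverse images commute with saturation within the domain. -/
theorem preimage_sat {X Y : SkewBoolSp.{u}} (m : SpHom X Y) (S : Set Y.E) {e : X.E} {e' : Y.E}
    (h : e' ∈ m.top e) : e' ∈ sat Y.p S ↔ e ∈ sat X.p (m.top.preimage S) := by
  have hc := m.isMor.comm _ _ h
  constructor
  · rintro ⟨s, hs, hse⟩
    rw [← hse] at hc
    obtain ⟨a, ⟨ha, ha'⟩, -⟩ := m.isMor.fiber _ _ hc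
    exact ⟨a, ⟨s, hs, ha'⟩, ha⟩
  · rintro ⟨a, ⟨s, hs, ha⟩, hae⟩
    have h1 := m.isMor.comm _ _ ha
    rw [hae] at h1
    exact ⟨s, hs, Part.mem_unique h1 hc⟩

/-- The homomorphism of algebras of copen sections given by inverse images. -/
def sectionHom {X Y : SkewBoolSp.{u}} (m : SpHom X Y) :
    SkewHom (CopenSection Y) (CopenSection X) where
  toFun := secPreimage m
  map_zero := by
    ext e
    change e ∈ m.top.preimage ∅ ↔ e ∈ (∅ : Set X.E)
    simp [PFun.mem_preimage]
  map_meet S R := by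
    ext e
    constructor
    · rintro ⟨e', ⟨h1, h2⟩, h3⟩
      exact ⟨(preimage_sat m _ h3).1 h1, e', h2, h3⟩
    · rintro ⟨h1, e', h2, h3⟩
      exact ⟨e', ⟨(preimage_sat m _ h3).2 h1, h2⟩, h3⟩
  map_join S R := by
    ext e
    constructor
    · rintro ⟨e', h1 | ⟨h1, h2⟩, h3⟩
      · exact Or.inl ⟨e', h1, h3⟩
      · exact Or.inr ⟨⟨e', h1, h3⟩, fun h => h2 ((preimage_sat m _ h3).2 h)⟩
    · rintro (⟨e', h1, h3⟩ | ⟨⟨e', h1, h3⟩, h2⟩)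
      · exact ⟨e', Or.inl h1, h3⟩
      · exact ⟨e', Or.inr ⟨h1, fun h => h2 ((preimage_sat m _ h3).1 h)⟩, h3⟩
  map_diff S R := by
    ext e
    constructor
    · rintro ⟨e', ⟨h1, h2⟩, h3⟩
      exact ⟨⟨e', h1, h3⟩, fun h => h2 ((preimage_sat m _ h3).2 h)⟩
    · rintro ⟨⟨e', h1, h3⟩, h2⟩
      exact ⟨e', ⟨h1, fun h => h2 ((preimage_sat m _ h3).1 h)⟩, h3⟩
  map_inter S R := by
    ext e
    constructor
    · rintro ⟨e', ⟨h1, h2⟩, h3⟩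
      exact ⟨⟨e', h1, h3⟩, e', h2, h3⟩
    · rintro ⟨⟨e', h1, h3⟩, e'', h2, h4⟩
      exact ⟨e', ⟨h1, Part.mem_unique h4 h3 ▸ h2⟩, h3⟩

/-- The functor of copen sections, from skew Boolean spaces to right-handed skew algebras. -/
def sectionFunctor : SkewBoolSp.{u}ᵒᵖ ⥤ RSkewAlg.{u} where
  obj X := sectionAlg X.unop
  map m := sectionHom m.unop
  map_id X := SkewHom.ext (funext fun S => CopenSection.ext (by
    ext e
    change e ∈ (PFun.id X.unop.E).preimage S.carrier ↔ _
    rw [← PFun.coe_id, PFun.coe_preimage]; rfl))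
  map_comp m n := SkewHom.ext (funext fun S => CopenSection.ext (PFun.preimage_comp _ _ _))

/-- The `≤`-ideal of those copen sections that are contained in `U`. -/
def idealOfOpen (X : SkewBoolSp.{u}) (U : Opens X.E) : LeIdeal (sectionAlg X) where
  carrier := {S : CopenSection X | S.carrier ⊆ U}
  zero_mem := Set.empty_subset _
  join_mem := by
    intro S R hS hR e he
    rcases he with he | he
    · exact hS he
    · exact hR he.1
  lower h hR := fun _ he => hR ((natLe_iff _ _).1 h he)

/-! ## From algebras to spaces: the skew spectrum -/

/-- Congruence relations on a skew algebra. -/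
structure SkewCongruence (A : Type u) [SkewAlgebra A] extends Setoid A where
  meet : ∀ {a b c d : A}, r a b → r c d → r (a ⊼ₛ c) (b ⊼ₛ d)
  join : ∀ {a b c d : A}, r a b → r c d → r (a ⊻ₛ c) (b ⊻ₛ d)
  diff : ∀ {a b c d : A}, r a b → r c d → r (a ∖ₛ c) (b ∖ₛ d)
  inter : ∀ {a b c d : A}, r a b → r c d → r (a ∩ₛ c) (b ∩ₛ d)

/-- Prime ideals of a skew algebra: proper subsets closed under finite joins and downward closed
for the natural preorder, such that `a ∧ b ∈ P` implies `a ∈ P` or `b ∈ P`. -/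
@[ext]
structure PrimeIdeal (A : Type u) [SkewAlgebra A] where
  carrier : Set A
  zero_mem : (0 : A) ∈ carrier
  join_mem : ∀ {x y : A}, x ∈ carrier → y ∈ carrier → x ⊻ₛ y ∈ carrier
  lower : ∀ {x y : A}, NatPre x y → y ∈ carrier → x ∈ carrier
  ne_univ : carrier ≠ Set.univ
  prime : ∀ {x y : A}, x ⊼ₛ y ∈ carrier → x ∈ carrier ∨ y ∈ carrier

section

variable {A : Type u} [SkewAlgebra A]

/-- `θ_P`, the least congruence whose zero-class contains `P`. -/
def theta (P : Set A) (x y : A) : Prop :=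
  ∀ c : SkewCongruence A, (∀ a ∈ P, c.r a 0) → c.r x y

theorem theta_refl (P : Set A) (x : A) : theta P x x := fun c _ => c.iseqv.refl x

/-- Points of the skew spectrum: pairs `(P, e)`, where `P` is a prime ideal and
`e = [t]` is the `θ_P`-class of some `t ∉ P`. -/
@[ext]
structure SkewSpectrum (A : Type u) [SkewAlgebra A] where
  ideal : PrimeIdeal A
  cls : Set A
  exists_rep : ∃ t, t ∉ ideal.carrier ∧ cls = {s | theta ideal.carrier s t}

/-- The point `P_t` of the skew spectrum, for `t ∉ P`. -/
def SkewSpectrum.mk' (P : PrimeIdeal A) (t : A) (ht : t ∉ P.carrier) : SkewSpectrum A :=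
  ⟨P, {s | theta P.carrier s t}, t, ht, rfl⟩

/-- The basic set `N_a` of the prime ideals that do not contain `a`. -/
def basicN (a : A) : Set (PrimeIdeal A) := {P | a ∉ P.carrier}

/-- The basic set `M_a` of the points `P_a` with `a ∉ P`. -/
def basicM (a : A) : Set (SkewSpectrum A) :=
  {x | ∃ (P : PrimeIdeal A) (h : a ∉ P.carrier), x = SkewSpectrum.mk' P a h}

/-- The topology of the spectrum is generated by the sets `N_a`. -/
instance : TopologicalSpace (PrimeIdeal A) := generateFrom (Set.range basicN)

/-- The topology of the skew spectrum is generated by the sets `M_a`. -/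
instance : TopologicalSpace (SkewSpectrum A) := generateFrom (Set.range basicM)

/-- The map `q_A` from the skew spectrum to the spectrum. -/
def specMap (A : Type u) [SkewAlgebra A] : SkewSpectrum A → PrimeIdeal A := SkewSpectrum.ideal

variable {A' : Type u} [SkewAlgebra A'] (f : SkewHom A A')

/-- The inverse image of a prime ideal, if it is proper. -/
def PrimeIdeal.comap (P : PrimeIdeal A') (a : A) (ha : f.toFun a ∉ P.carrier) : PrimeIdeal A where
  carrier := f.toFun ⁻¹' P.carrier
  zero_mem := by rw [Set.mem_preimage, f.map_zero]; exact P.zero_mem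
  join_mem hx hy := by rw [Set.mem_preimage, f.map_join]; exact P.join_mem hx hy
  lower {x y} h hy := by
    refine P.lower (y := f.toFun y) ?_ hy
    have h' := congrArg f.toFun h
    rwa [f.map_meet, f.map_meet] at h'
  ne_univ h := ha (show a ∈ f.toFun ⁻¹' P.carrier from h ▸ Set.mem_univ a)
  prime h := by
    rw [Set.mem_preimage, f.map_meet] at h
    exact P.prime h

/-- The partial map `f_↓` between spectra: `P ↦ f⁻¹(P)`, defined when `f⁻¹(P) ≠ A`. -/
noncomputable def downMap : PrimeIdeal A' →. PrimeIdeal A := fun P =>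
  ⟨∃ a, f.toFun a ∉ P.carrier, fun h => P.comap f h.choose h.choose_spec⟩

/-- The partial map `f^↑` between skew spectra: `P_{f(a)} ↦ (f⁻¹(P))_a`, defined at
the points of the form `P_{f(a)}` with `f(a) ∉ P`. -/
noncomputable def upMap : SkewSpectrum A' →. SkewSpectrum A := fun x =>
  ⟨∃ a, ∃ h : f.toFun a ∉ x.ideal.carrier, x = SkewSpectrum.mk' x.ideal (f.toFun a) h, fun h =>
    SkewSpectrum.mk' (x.ideal.comap f h.choose h.choose_spec.choose) h.choose
      h.choose_spec.choose⟩

end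

/-- The statement that the skew spectrum is a contravariant functor: `q_A` is a skew Boolean space
for every right-handed skew algebra `A`, every homomorphism `f` induces a morphism `(f^↑, f_↓)`
between them, where the value of `f^↑` at `P_{f(a)}` is `(f⁻¹(P))_a` whichever `a` is used, and
identities and composites are preserved. -/
structure SpectrumIsFunctor : Prop where
  isSkew : ∀ A : RSkewAlg.{u}, IsSkewBooleanSpace (specMap A)
  isMor : ∀ {A A' : RSkewAlg.{u}} (f : A ⟶ A'),
    IsSkewMorphism (specMap A') (specMap A) (upMap f) (downMap f)
  upMap_apply : ∀ {A A' : RSkewAlg.{u}} (f : A ⟶ A') (P : PrimeIdeal A') (a : A)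
    (h : SkewHom.toFun f a ∉ P.carrier),
    SkewSpectrum.mk' (P.comap f a h) a h ∈ upMap f (SkewSpectrum.mk' P (SkewHom.toFun f a) h)
  upMap_id : ∀ A : RSkewAlg.{u}, upMap (𝟙 A) = PFun.id _
  downMap_id : ∀ A : RSkewAlg.{u}, downMap (𝟙 A) = PFun.id _
  upMap_comp : ∀ {A A' A'' : RSkewAlg.{u}} (f : A ⟶ A') (g : A' ⟶ A''),
    upMap (f ≫ g) = (upMap f).comp (upMap g)
  downMap_comp : ∀ {A A' A'' : RSkewAlg.{u}} (f : A ⟶ A') (g : A' ⟶ A''),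
    downMap (f ≫ g) = (downMap f).comp (downMap g)

/-- The skew Boolean space `q_A` from the skew spectrum of `A` to its spectrum. -/
def spectrumObj (h : SpectrumIsFunctor.{u}) (A : RSkewAlg.{u}) : SkewBoolSp.{u} where
  E := SkewSpectrum A
  B := PrimeIdeal A
  p := specMap A
  isSkew := h.isSkew A

/-- The skew spectrum functor. -/
noncomputable def spectrumFunctor (h : SpectrumIsFunctor.{u}) :
    RSkewAlg.{u}ᵒᵖ ⥤ SkewBoolSp.{u} where
  obj A := spectrumObj h A.unop
  map {A A'} f := SpHom.mk (X := spectrumObj h A.unop) (Y := spectrumObj h A'.unop)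
    (upMap f.unop) (downMap f.unop) (h.isMor f.unop)
  map_id A := SpHom.ext (h.upMap_id A.unop) (h.downMap_id A.unop)
  map_comp f g := SpHom.ext (h.upMap_comp g.unop f.unop) (h.downMap_comp g.unop f.unop)

/-- The open subset of the skew spectrum that is the union of the sets `M_a` with `a ∈ I`. -/
def openOfIdeal {A : Type u} [SkewAlgebra A] (I : LeIdeal A) : Opens (SkewSpectrum A) :=
  ⟨⋃ a ∈ I.carrier, basicM a,
    isOpen_biUnion fun a _ => isOpen_generateFrom_of_mem ⟨a, rfl⟩⟩

end SkewStone

namespace SkewStone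

open SkewLattice SkewAlgebra

/-! ## Elementary theory of right-handed skew algebras -/

section order

variable {A : Type u} [SkewAlgebra A]

/-! The elements of a right-handed skew algebra behave like sections of an étale map: `a ⊼ₛ b` is
`b` cut down to the support of `a`, `a ⊻ₛ b` extends `a` by `b` off the support of `a`, `∩ₛ` is
intersection, and a prime ideal plays the part of a base point, being the set of sections not
defined there. The proof makes this picture literal.

Algebra: elements with a common upper bound commute (`meet_comm_of_natLe`), so right-handed algebras
are right normal. This allows the congruence `theta` to be computed: for `b` outside `P`, `a` is
related to `b` exactly when `a ∩ₛ b` is outside `P` (`PrimeIdeal.theta_iff`). A point of the skew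
spectrum is thus a germ of sections, and membership in its class obeys the set-theoretic rules for
sections (`meet_mem_cls_iff` and its companions).

Topology: the sets `M_a` form a basis because `M_a ∩ M_b = M_{a ∩ b}`, the sets `N_a` are compact by
an ultrafilter argument, differences separate points, and `q_A` is injective on each `M_a`. A
homomorphism `f` pulls `M_a` and `N_a` back to `M_{f a}` and `N_{f a}`, which gives continuity and
properness at once.

Duality: `a ↦ M_a` is injective because every nonzero element is avoided by some prime ideal
(`exists_prime_notMem`), and surjective because a compact open set on which `q_A` is injective is a
finite union of sets `M_a`, and such unions are joins. In the other direction, compactness forces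
every prime ideal of the algebra of copen sections to come from a base point
(`basePoint_surjective`), so a space is recovered from its sections.

Restriction: an open `U` corresponds to the ideal of the copen sections inside `U`; again by
compactness every `≤`-ideal has this form (`idealOfOpen_openOfSections`). The partial identity on
`U` is sent to the inclusion of this ideal, and full faithfulness together with naturality carries
the matching of the two classes to all morphisms and to both functors. -/

theorem NatLe.refl (x : A) : NatLe x x := ⟨meet_self x, meet_self x⟩

theorem NatLe.trans {x y z : A} (h : NatLe x y) (h' : NatLe y z) : NatLe x z :=
  ⟨by rw [← h.1, SkewLattice.meet_assoc, h'.1], by rw [← h.2, ← SkewLattice.meet_assoc, h'.2]⟩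

theorem NatLe.antisymm {x y : A} (h : NatLe x y) (h' : NatLe y x) : x = y := by
  rw [← h.1, h'.2]

theorem NatLe.pre {x y : A} (h : NatLe x y) : NatPre x y := by
  rw [NatPre, h.1, meet_self]

theorem meet_natPre_left (x y : A) : NatPre (x ⊼ₛ y) x := by
  rw [NatPre, SkewLattice.meet_assoc, ← SkewLattice.meet_assoc x x y, meet_self, meet_self]

theorem meet_natPre_right (x y : A) : NatPre (x ⊼ₛ y) y := by
  rw [NatPre, SkewLattice.meet_assoc x y y, meet_self, meet_self]

theorem natPre_join_left (x y : A) : NatPre x (x ⊻ₛ y) := by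
  rw [NatPre, meet_join_absorb, meet_self]

theorem natPre_join_right (x y : A) : NatPre y (x ⊻ₛ y) := by
  rw [NatPre, SkewLattice.meet_assoc, join_meet_absorb, meet_self]

theorem meet_eq_zero_comm {x y : A} (h : x ⊼ₛ y = 0) : y ⊼ₛ x = 0 := by
  rw [← meet_self (y ⊼ₛ x), SkewLattice.meet_assoc, ← SkewLattice.meet_assoc x y x, h, zero_meet,
    meet_zero]

theorem inter_comm (x y : A) : x ∩ₛ y = y ∩ₛ x :=
  (le_inter _ _ _ (inter_le_right _ _) (inter_le_left _ _)).antisymm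
    (le_inter _ _ _ (inter_le_right _ _) (inter_le_left _ _))

theorem inter_eq_of_natLe {x y : A} (h : NatLe x y) : x ∩ₛ y = x :=
  (inter_le_left x y).antisymm (le_inter _ _ _ (NatLe.refl x) h)

end order

section rightHanded

variable {A : RSkewAlg.{u}}

theorem natPre_iff {x y : A} : NatPre x y ↔ y ⊼ₛ x = x := by
  rw [NatPre, A.rightHanded]

theorem meet_natLe_right (x y : A) : NatLe (x ⊼ₛ y) y :=
  ⟨by rw [SkewLattice.meet_assoc, meet_self],
    by rw [← SkewLattice.meet_assoc, A.rightHanded]⟩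

theorem diff_meet_right (x y : A) : (x ∖ₛ y) ⊼ₛ y = 0 := by
  have h := diff_meet x y
  rw [A.rightHanded] at h
  have h' := meet_eq_zero_comm h
  rw [SkewLattice.meet_assoc, (diff_le x y).2] at h'
  exact meet_eq_zero_comm h'

/-- Elements with a common upper bound commute. -/
theorem meet_comm_of_natLe {x y b : A} (hx : NatLe x b) (hy : NatLe y b) :
    x ⊼ₛ y = y ⊼ₛ x := by
  -- As `y ≤ b`, the bound splits as `b = (b ∖ₛ y) ⊻ₛ y`. Meeting with `x` splits `x` into a part
  -- annihilated by `y` and the part `x ⊼ₛ y`.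
  have h : x = (x ⊼ₛ (b ∖ₛ y)) ⊻ₛ (x ⊼ₛ y) := by
    have h1 := diff_join b y
    rw [hy.2, hy.1] at h1
    rw [← meet_join_distrib, h1, hx.1]
  have h2 : y ⊼ₛ (x ⊼ₛ (b ∖ₛ y)) = 0 := by
    rw [← SkewLattice.meet_assoc, ← A.rightHanded (b ∖ₛ y), ← SkewLattice.meet_assoc,
      diff_meet_right, zero_meet, zero_meet]
  have h3 : y ⊼ₛ x = y ⊼ₛ (x ⊼ₛ y) := by
    conv_lhs => rw [h]
    rw [meet_join_distrib, h2, zero_join]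
  rw [h3, ← SkewLattice.meet_assoc, A.rightHanded]

/-- Right-handed skew algebras are right normal. -/
theorem meet_left_comm (x y z : A) : x ⊼ₛ (y ⊼ₛ z) = y ⊼ₛ (x ⊼ₛ z) := by
  -- Both `x ⊼ₛ z` and `y ⊼ₛ z` lie below `z`, so they commute; right-handedness then deletes the
  -- inner copy of `z`.
  have h := meet_comm_of_natLe (meet_natLe_right x z) (meet_natLe_right y z)
  rwa [SkewLattice.meet_assoc, ← SkewLattice.meet_assoc z, A.rightHanded, SkewLattice.meet_assoc y,
    ← SkewLattice.meet_assoc z x, A.rightHanded] at h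

theorem NatLe.meet {m n a c : A} (h : NatLe m a) (h' : NatLe n c) :
    NatLe (m ⊼ₛ n) (a ⊼ₛ c) := by
  constructor
  · rw [SkewLattice.meet_assoc, meet_left_comm n a, ← SkewLattice.meet_assoc, h.1, h'.1]
  · rw [SkewLattice.meet_assoc, meet_left_comm c m, ← SkewLattice.meet_assoc, h.2, h'.2]

/-- Distributing `(a ⊻ₛ c) ⊼ₛ a` gives `a ⊻ₛ (c ⊼ₛ a)`, and `c ⊼ₛ a ≤ a` makes the second term
absorbable. This concerns the left joinand only; of the right one, just the part disjoint from `a`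
is handled by `natLe_join_right`. -/
theorem natLe_join_left (a c : A) : NatLe a (a ⊻ₛ c) := by
  refine ⟨meet_join_absorb a c, ?_⟩
  have h := join_meet_absorb' a (c ⊼ₛ a)
  rw [(meet_natLe_right c a).2] at h
  rw [join_meet_distrib, meet_self, h]

theorem natLe_join_right {m a c : A} (h : NatLe m c) (h' : m ⊼ₛ a = 0) : NatLe m (a ⊻ₛ c) := by
  constructor
  · rw [meet_join_distrib, h', h.1, zero_join]
  · rw [join_meet_distrib, meet_eq_zero_comm h', h.2, zero_join]

/-- In the decomposition of `a` into `a ∖ₛ c` and `a ⊼ₛ c ⊼ₛ a`, an element disjoint from `c`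
annihilates the second piece, so it sees only the first. -/
theorem natLe_diff {m a c : A} (h : NatLe m a) (h' : m ⊼ₛ c = 0) : NatLe m (a ∖ₛ c) := by
  have h1 := diff_join a c
  constructor
  · have h2 : m ⊼ₛ ((a ∖ₛ c) ⊻ₛ (a ⊼ₛ c ⊼ₛ a)) = m := by rw [h1, h.1]
    rwa [meet_join_distrib, ← SkewLattice.meet_assoc m, ← SkewLattice.meet_assoc m, h.1, h',
      zero_meet, join_zero] at h2
  · have h2 : ((a ∖ₛ c) ⊻ₛ (a ⊼ₛ c ⊼ₛ a)) ⊼ₛ m = m := by rw [h1, h.2]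
    rwa [join_meet_distrib, SkewLattice.meet_assoc, h.2, SkewLattice.meet_assoc,
      meet_eq_zero_comm h', meet_zero, join_zero] at h2

theorem NatLe.meet_eq_zero {m a c : A} (h : NatLe m a) (h' : a ⊼ₛ c = 0) : m ⊼ₛ c = 0 := by
  rw [← h.1, SkewLattice.meet_assoc, h', meet_zero]

/-! ## Membership in prime ideals -/

namespace PrimeIdeal

variable (P : PrimeIdeal A)

theorem mem_join_iff {a b : A} : a ⊻ₛ b ∈ P.carrier ↔ a ∈ P.carrier ∧ b ∈ P.carrier :=
  ⟨fun h => ⟨P.lower (natPre_join_left a b) h, P.lower (natPre_join_right a b) h⟩,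
    fun h => P.join_mem h.1 h.2⟩

theorem mem_meet_iff {a b : A} : a ⊼ₛ b ∈ P.carrier ↔ a ∈ P.carrier ∨ b ∈ P.carrier :=
  ⟨P.prime, fun h => h.elim (P.lower (meet_natPre_left a b)) (P.lower (meet_natPre_right a b))⟩

theorem mem_of_natLe {a b : A} (h : NatLe a b) (hb : b ∈ P.carrier) : a ∈ P.carrier :=
  P.lower h.pre hb

/-- Primality applied to `(a ∖ₛ b) ⊼ₛ b = 0`: off the support of nothing but `b` is anything
removed, so modulo `P` the difference is `a` when `b ∈ P` and zero otherwise. -/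
theorem mem_diff_iff {a b : A} : a ∖ₛ b ∈ P.carrier ↔ (b ∈ P.carrier → a ∈ P.carrier) := by
  constructor
  · intro h hb
    rw [← diff_join a b, mem_join_iff, mem_meet_iff, mem_meet_iff]
    exact ⟨h, Or.inl (Or.inr hb)⟩
  · intro h
    by_cases hb : b ∈ P.carrier
    · exact P.mem_of_natLe (diff_le a b) (h hb)
    · have h0 : (a ∖ₛ b) ⊼ₛ b ∈ P.carrier := by rw [diff_meet_right]; exact P.zero_mem
      exact (P.prime h0).resolve_right hb

theorem exists_notMem : ∃ a, a ∉ P.carrier := (Set.ne_univ_iff_exists_notMem _).1 P.ne_univ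

/-! ## The congruence of a prime ideal -/

/-- An explicit description of the congruence `θ_P`. -/
def Rel (a b : A) : Prop := (a ∈ P.carrier ↔ b ∈ P.carrier) ∧ (a ∉ P.carrier → a ∩ₛ b ∉ P.carrier)

variable {P}

/-- The tool for checking that `Rel` is a congruence: each compatibility reduces to exhibiting one
common lower bound outside `P`. -/
theorem rel_of_lower {m a b : A} (hm : m ∉ P.carrier) (ha : NatLe m a) (hb : NatLe m b) :
    P.Rel a b := by
  have ha' := fun h => hm (P.mem_of_natLe ha h)
  have hb' := fun h => hm (P.mem_of_natLe hb h)
  exact ⟨iff_of_false ha' hb', fun _ h => hm (P.mem_of_natLe (le_inter _ _ _ ha hb) h)⟩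

theorem rel_of_mem {a b : A} (ha : a ∈ P.carrier) (hb : b ∈ P.carrier) : P.Rel a b :=
  ⟨iff_of_true ha hb, fun h => (h ha).elim⟩

theorem Rel.symm {a b : A} (h : P.Rel a b) : P.Rel b a :=
  ⟨h.1.symm, fun hb => by rw [inter_comm]; exact h.2 fun ha => hb (h.1.1 ha)⟩

theorem Rel.trans {a b c : A} (h : P.Rel a b) (h' : P.Rel b c) : P.Rel a c := by
  by_cases ha : a ∈ P.carrier
  · exact rel_of_mem ha (h'.1.1 (h.1.1 ha))
  · have hm := h.2 ha
    have hn := h'.2 fun hb => ha (h.1.2 hb)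
    -- Both factors lie below `b`, so they commute, and their meet is below each of them; primality
    -- keeps it outside `P`.
    refine rel_of_lower (m := (a ∩ₛ b) ⊼ₛ (b ∩ₛ c)) (fun h => (P.prime h).elim hm hn) ?_
      ((meet_natLe_right _ _).trans (inter_le_right _ _))
    rw [meet_comm_of_natLe (inter_le_right a b) (inter_le_left b c)]
    exact (meet_natLe_right _ _).trans (inter_le_left _ _)

theorem Rel.inter {a b c d : A} (h : P.Rel a b) (h' : P.Rel c d) : P.Rel (a ∩ₛ c) (b ∩ₛ d) := by
  have key : ∀ {a b c d : A}, P.Rel a b → P.Rel c d → a ∩ₛ c ∉ P.carrier →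
      P.Rel (a ∩ₛ c) (b ∩ₛ d) := by
    intro a b c d h h' hk
    have hm := h.2 fun ha => hk (P.mem_of_natLe (inter_le_left _ _) ha)
    have hn := h'.2 fun hc => hk (P.mem_of_natLe (inter_le_right _ _) hc)
    -- The lower bound is the meet of `a ∩ₛ b` and `c ∩ₛ d`, each first cut by `a ∩ₛ c`. The
    -- commutations hold below `a`, below `c` and below `a ∩ₛ c` respectively, and place this
    -- element under all three intersections.
    have e1 := meet_comm_of_natLe (inter_le_left a b) (inter_le_left a c)
    have e2 := meet_comm_of_natLe (inter_le_right a c) (inter_le_left c d)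
    have e3 := meet_comm_of_natLe (meet_natLe_right (a ∩ₛ b) (a ∩ₛ c))
      (meet_natLe_right (c ∩ₛ d) (a ∩ₛ c))
    have l1 : NatLe ((a ∩ₛ b) ⊼ₛ (a ∩ₛ c) ⊼ₛ ((c ∩ₛ d) ⊼ₛ (a ∩ₛ c))) (a ∩ₛ b) := by
      rw [e3, e1]
      exact (meet_natLe_right _ _).trans (meet_natLe_right _ _)
    have l2 : NatLe ((a ∩ₛ b) ⊼ₛ (a ∩ₛ c) ⊼ₛ ((c ∩ₛ d) ⊼ₛ (a ∩ₛ c))) (c ∩ₛ d) := by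
      rw [← e2]
      exact (meet_natLe_right _ _).trans (meet_natLe_right _ _)
    refine rel_of_lower ?_ ((meet_natLe_right _ _).trans (meet_natLe_right _ _))
      (le_inter _ _ _ (l1.trans (inter_le_right _ _)) (l2.trans (inter_le_right _ _)))
    rw [mem_meet_iff, mem_meet_iff, mem_meet_iff]
    tauto
  by_cases h1 : a ∩ₛ c ∈ P.carrier
  · by_cases h2 : b ∩ₛ d ∈ P.carrier
    · exact rel_of_mem h1 h2
    · exact (key h.symm h'.symm h2).symm
  · exact key h h' h1

variable (P) in
/-- The relation `P.Rel` as a congruence. -/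
def congruence : SkewCongruence A where
  r := P.Rel
  iseqv := ⟨fun a => ⟨Iff.rfl, fun h => by rwa [inter_eq_of_natLe (NatLe.refl a)]⟩,
    Rel.symm, Rel.trans⟩
  meet {a b c d} h h' := by
    by_cases hac : a ⊼ₛ c ∈ P.carrier
    · refine rel_of_mem hac ?_
      rw [mem_meet_iff] at hac ⊢
      exact hac.imp h.1.1 h'.1.1
    · rw [mem_meet_iff, not_or] at hac
      refine rel_of_lower (m := (a ∩ₛ b) ⊼ₛ (c ∩ₛ d)) ?_
        ((inter_le_left _ _).meet (inter_le_left _ _))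
        ((inter_le_right _ _).meet (inter_le_right _ _))
      exact fun h1 => (P.prime h1).elim (h.2 hac.1) (h'.2 hac.2)
  join {a b c d} h h' := by
    by_cases ha : a ∈ P.carrier
    · by_cases hc : c ∈ P.carrier
      · exact rel_of_mem (P.join_mem ha hc) (P.join_mem (h.1.1 ha) (h'.1.1 hc))
      -- Here `c ∩ₛ d` counts only where the left joinands vanish. Removing `a` and `b` makes it
      -- disjoint from both, hence a lower bound of both joins; it stays outside `P` because `a` and
      -- `b` are in `P`.
      · have l1 := diff_le ((c ∩ₛ d) ∖ₛ a) b
        have l2 := l1.trans (diff_le (c ∩ₛ d) a)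
        refine rel_of_lower (m := ((c ∩ₛ d) ∖ₛ a) ∖ₛ b) ?_
          (natLe_join_right (l2.trans (inter_le_left _ _)) (l1.meet_eq_zero (diff_meet_right _ _)))
          (natLe_join_right (l2.trans (inter_le_right _ _)) (diff_meet_right _ _))
        rw [mem_diff_iff, mem_diff_iff]
        exact fun h1 => h'.2 hc (h1 (h.1.1 ha) ha)
    · exact rel_of_lower (h.2 ha) ((inter_le_left _ _).trans (natLe_join_left _ _))
        ((inter_le_right _ _).trans (natLe_join_left _ _))
  diff {a b c d} h h' := by
    by_cases hac : a ∖ₛ c ∈ P.carrier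
    · refine rel_of_mem hac ?_
      rw [mem_diff_iff] at hac ⊢
      exact fun h1 => h.1.1 (hac (h'.1.2 h1))
    · rw [mem_diff_iff, Classical.not_imp] at hac
      -- Removing both `c` and `d`, which lie in `P`, makes the common part of `a` and `b` a lower
      -- bound of both differences without moving it into `P`.
      have l1 := diff_le ((a ∩ₛ b) ∖ₛ c) d
      have l2 := l1.trans (diff_le (a ∩ₛ b) c)
      refine rel_of_lower (m := ((a ∩ₛ b) ∖ₛ c) ∖ₛ d) ?_
        (natLe_diff (l2.trans (inter_le_left _ _)) (l1.meet_eq_zero (diff_meet_right _ _)))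
        (natLe_diff (l2.trans (inter_le_right _ _)) (diff_meet_right _ _))
      rw [mem_diff_iff, mem_diff_iff]
      exact fun h1 => h.2 hac.2 (h1 (h'.1.1 hac.1) hac.1)
  inter := Rel.inter

/-- `Rel` is itself a congruence whose zero-class contains `P`, so it contains `theta`. Conversely,
let `m = a ∩ₛ b` be outside `P`. Any `s ≥ m` equals `(s ∖ₛ m) ⊻ₛ m` with `s ∖ₛ m ∈ P`, so a
congruence collapsing `P` identifies `s` with `m`; this applies to `a` and to `b`. -/
theorem theta_iff_rel {a b : A} : theta P.carrier a b ↔ P.Rel a b := by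
  constructor
  · intro h
    exact h P.congruence fun p hp => rel_of_mem hp P.zero_mem
  · intro h c hc
    by_cases ha : a ∈ P.carrier
    · exact c.iseqv.trans (hc a ha) (c.iseqv.symm (hc b (h.1.1 ha)))
    · have hm := h.2 ha
      have key : ∀ s : A, NatLe (a ∩ₛ b) s → c.r s (a ∩ₛ b) := by
        intro s hs
        have e := diff_join s (a ∩ₛ b)
        rw [hs.2, hs.1] at e
        have h1 := c.join (hc (s ∖ₛ (a ∩ₛ b)) (P.mem_diff_iff.2 fun h' => (hm h').elim))
          (c.iseqv.refl (a ∩ₛ b))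
        rwa [e, zero_join] at h1
      exact c.iseqv.trans (key a (inter_le_left _ _)) (c.iseqv.symm (key b (inter_le_right _ _)))

theorem theta_iff {a b : A} (hb : b ∉ P.carrier) :
    theta P.carrier a b ↔ a ∩ₛ b ∉ P.carrier := by
  rw [theta_iff_rel]
  exact ⟨fun h => h.2 fun ha => hb (h.1.1 ha),
    fun h => rel_of_lower h (inter_le_left _ _) (inter_le_right _ _)⟩

end PrimeIdeal

/-! ## Existence of prime ideals -/

/-- A set of elements with the properties of a prime ideal except primality and properness. -/
structure IsPreIdeal (S : Set A) : Prop where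
  zero_mem : (0 : A) ∈ S
  join_mem : ∀ {x y : A}, x ∈ S → y ∈ S → x ⊻ₛ y ∈ S
  lower : ∀ {x y : A}, NatPre x y → y ∈ S → x ∈ S

/-- By right-handedness `x ⊼ₛ z = z` means `z ≼ x`, and `x` precedes every join in which it occurs.
-/
theorem join_meet_eq {x y z : A} (h : x ⊼ₛ z = z) : (x ⊻ₛ y) ⊼ₛ z = z ∧ (y ⊻ₛ x) ⊼ₛ z = z := by
  have h1 := natPre_iff.1 (natPre_join_left x y)
  have h2 := natPre_iff.1 (natPre_join_right y x)
  constructor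
  · rw [← h, ← SkewLattice.meet_assoc, h1]
  · rw [← h, ← SkewLattice.meet_assoc, h2]

/-- The ideal generated by an ideal and an element. -/
theorem IsPreIdeal.adjoin {S : Set A} (hS : IsPreIdeal S) (x : A) :
    IsPreIdeal {z : A | ∃ p ∈ S, (p ⊻ₛ x) ⊼ₛ z = z} where
  zero_mem := ⟨0, hS.zero_mem, meet_zero _⟩
  join_mem := by
    rintro z w ⟨p, hp, hz⟩ ⟨q, hq, hw⟩
    refine ⟨p ⊻ₛ q, hS.join_mem hp hq, ?_⟩
    -- The witness may be enlarged by a join on either side. On the right the new element lands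
    -- between `r` and `x`, so `r ⊻ₛ x ≼ r ⊻ₛ s ⊻ₛ x` has to be verified by distributing.
    have aux : ∀ {r s v : A}, (r ⊻ₛ x) ⊼ₛ v = v →
        (r ⊻ₛ s ⊻ₛ x) ⊼ₛ v = v ∧ (s ⊻ₛ r ⊻ₛ x) ⊼ₛ v = v := by
      intro r s v h
      constructor
      · have e : (r ⊻ₛ s ⊻ₛ x) ⊼ₛ (r ⊻ₛ x) = r ⊻ₛ x := by
          rw [meet_join_distrib,
            (join_meet_eq (join_meet_eq (meet_self r)).1).1, join_meet_absorb]
        rw [← h, ← SkewLattice.meet_assoc, e]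
      · rw [SkewLattice.join_assoc]
        exact (join_meet_eq h).2
    rw [meet_join_distrib, (aux hz).1, (aux hw).2]
  lower := by
    rintro z w h ⟨p, hp, hw⟩
    refine ⟨p, hp, ?_⟩
    rw [natPre_iff] at h
    rw [← h, ← SkewLattice.meet_assoc, hw]

/-- A nonzero element is avoided by some prime ideal. -/
theorem exists_prime_notMem {c : A} (hc : c ≠ 0) : ∃ P : PrimeIdeal A, c ∉ P.carrier := by
  -- Take `M` maximal among the ideals avoiding `c`, starting from the zero ideal.
  obtain ⟨M, hM0, hM⟩ := zorn_subset_nonempty {S : Set A | IsPreIdeal S ∧ c ∉ S}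
    (by
      intro C hC hch hne
      obtain ⟨S0, hS0⟩ := hne
      refine ⟨⋃₀ C, ⟨⟨⟨S0, hS0, (hC hS0).1.zero_mem⟩, ?_, ?_⟩, ?_⟩,
        fun s hs => Set.subset_sUnion_of_mem hs⟩
      · rintro x y ⟨S, hS, hx⟩ ⟨T, hT, hy⟩
        rcases hch.total hS hT with h | h
        · exact ⟨T, hT, (hC hT).1.join_mem (h hx) hy⟩
        · exact ⟨S, hS, (hC hS).1.join_mem hx (h hy)⟩
      · rintro x y h ⟨S, hS, hy⟩
        exact ⟨S, hS, (hC hS).1.lower h hy⟩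
      · rintro ⟨S, hS, hcS⟩
        exact (hC hS).2 hcS)
    {0} ⟨⟨rfl, by rintro x y rfl rfl; exact zero_join 0, fun {x y} h hy => by
      rw [Set.mem_singleton_iff.1 hy, natPre_iff, zero_meet] at h; exact h.symm⟩, hc⟩
  have hMI := hM.prop.1
  -- By maximality, adjoining any `x ∉ M` captures `c`.
  have hmem : ∀ x, x ∉ M → ∃ p ∈ M, (p ⊻ₛ x) ⊼ₛ c = c := by
    intro x hx
    by_contra hcon
    have hle : M ⊆ {z : A | ∃ p ∈ M, (p ⊻ₛ x) ⊼ₛ z = z} := fun p hp =>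
      ⟨p, hp, natPre_iff.1 (natPre_join_left p x)⟩
    have := hM.le_of_ge ⟨hMI.adjoin x, hcon⟩ hle
    exact hx (this ⟨0, hMI.zero_mem, by rw [zero_join, meet_self]⟩)
  refine ⟨⟨M, hMI.zero_mem, hMI.join_mem, hMI.lower,
    fun h => hM.prop.2 (h ▸ Set.mem_univ c), ?_⟩, hM.prop.2⟩
  intro x y hxy
  by_contra hcon
  rw [not_or] at hcon
  obtain ⟨p, hp, hpc⟩ := hmem x hcon.1
  obtain ⟨q, hq, hqc⟩ := hmem y hcon.2
  have h1 : ((p ⊻ₛ x) ⊼ₛ (q ⊻ₛ y)) ⊼ₛ c = c := by rw [SkewLattice.meet_assoc, hqc, hpc]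
  -- If `x` and `y` were both outside `M`, then `c ≼ (p ⊻ₛ x) ⊼ₛ (q ⊻ₛ y)`. Each of the four terms
  -- of the expanded product has a factor in `M` or is `x ⊼ₛ y`, so `c` would lie in `M`.
  have h2 : (p ⊻ₛ x) ⊼ₛ (q ⊻ₛ y) ∈ M := by
    rw [meet_join_distrib, join_meet_distrib, join_meet_distrib]
    exact hMI.join_mem
      (hMI.join_mem (hMI.lower (meet_natPre_left _ _) hp) (hMI.lower (meet_natPre_right _ _) hq))
      (hMI.join_mem (hMI.lower (meet_natPre_left _ _) hp) hxy)
  exact hM.prop.2 (hMI.lower (natPre_iff.2 h1) h2)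

end rightHanded

open Topology

/-! ## Boolean spaces and proper partial maps -/

section topology

variable {X Y : Type u} [TopologicalSpace X] [TopologicalSpace Y]

/-- In a Hausdorff space compact sets are closed, so a basis of compact open sets gives both local
compactness and a basis of clopen sets. -/
theorem isBooleanSpace_of_basis [T2Space X] {𝓑 : Set (Set X)} (hb : IsTopologicalBasis 𝓑)
    (hc : ∀ s ∈ 𝓑, IsCompact s) : IsBooleanSpace X := by
  refine ⟨⟨fun x n hn => ?_⟩, inferInstance, ?_⟩
  · obtain ⟨s, hs, hx, hsn⟩ := hb.mem_nhds_iff.1 hn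
    exact ⟨s, (hb.isOpen hs).mem_nhds hx, hsn, hc s hs⟩
  · refine isTopologicalBasis_of_isOpen_of_nhds (fun s hs => hs.2) fun x s hx hs => ?_
    obtain ⟨t, ht, hxt, hts⟩ := hb.exists_subset_of_mem_open hx hs
    exact ⟨t, ⟨(hc t ht).isClosed, hb.isOpen ht⟩, hxt, hts⟩

theorem IsBooleanSpace.exists_compactOpen (h : IsBooleanSpace X) {x : X} {U : Set X}
    (hU : IsOpen U) (hx : x ∈ U) : ∃ V, IsOpen V ∧ IsCompact V ∧ x ∈ V ∧ V ⊆ U := by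
  obtain ⟨h1, h2, h3⟩ := h
  obtain ⟨K, hK, hKU, hKc⟩ := local_compact_nhds (hU.mem_nhds hx)
  obtain ⟨V, hV, hxV, hVK⟩ := h3.mem_nhds_iff.1 hK
  exact ⟨V, hV.2, hKc.of_isClosed_subset hV.1 hVK, hxV, hVK.trans hKU⟩

/-- Openness of preimages passes from a basis to all open sets. For properness, a compact set is
covered by finitely many basic sets, whose preimages have a compact union, and its own preimage is
cut out of that union by removing an open set. -/
theorem isProperPartial_of_basis [T2Space Y] {𝓑 : Set (Set Y)} (hb : IsTopologicalBasis 𝓑)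
    {f : X →. Y} (ho : ∀ s ∈ 𝓑, IsOpen (f.preimage s))
    (hc : ∀ s ∈ 𝓑, IsCompact (f.preimage s)) : IsProperPartial f := by
  have hf : PContinuous f := by
    intro s hs
    rw [isOpen_iff_forall_mem_open]
    rintro x ⟨y, hy, hyx⟩
    obtain ⟨t, ht, hyt, hts⟩ := hb.exists_subset_of_mem_open hy hs
    exact ⟨_, PFun.preimage_mono _ hts, ho t ht, y, hyt, hyx⟩
  refine ⟨hf, fun K hK => ?_⟩
  have hU : ∀ y : Y, ∃ s ∈ 𝓑, y ∈ s := fun y => by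
    obtain ⟨s, hs, hy, -⟩ := hb.exists_subset_of_mem_open (Set.mem_univ y) isOpen_univ
    exact ⟨s, hs, hy⟩
  choose U hUb hyU using hU
  obtain ⟨t, -, ht⟩ := hK.elim_nhds_subcover U fun y _ => (hb.isOpen (hUb y)).mem_nhds (hyU y)
  have h1 : IsCompact (⋃ y ∈ t, f.preimage (U y)) :=
    t.isCompact_biUnion fun y _ => hc _ (hUb y)
  -- For a partial map the preimage of the complement is not the complement of the preimage; the
  -- identity holds because the cover already forces `x` into the domain.
  have h2 : f.preimage K = (⋃ y ∈ t, f.preimage (U y)) \ f.preimage Kᶜ := by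
    ext x
    simp only [Set.mem_sdiff, Set.mem_iUnion, PFun.mem_preimage, Set.mem_compl_iff, not_exists,
      not_and]
    constructor
    · rintro ⟨y, hy, hyx⟩
      obtain ⟨i, hi, hyi⟩ := Set.mem_iUnion₂.1 (ht hy)
      exact ⟨⟨i, hi, y, hyi, hyx⟩, fun z hz hzx => hz (Part.mem_unique hyx hzx ▸ hy)⟩
    · rintro ⟨⟨i, hi, y, hyi, hyx⟩, h⟩
      exact ⟨y, by_contra fun hy => h y hy hyx, hyx⟩
  rw [h2]
  exact h1.diff (hf _ hK.isClosed.isOpen_compl)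

end topology

variable {A : RSkewAlg.{u}}

/-! ## The spectrum -/

theorem isOpen_basicN (a : A) : IsOpen (basicN a) := isOpen_generateFrom_of_mem ⟨a, rfl⟩

theorem mem_basicN {a : A} {P : PrimeIdeal A} : P ∈ basicN a ↔ a ∉ P.carrier := Iff.rfl

theorem isTopologicalBasis_basicN : IsTopologicalBasis (Set.range (basicN (A := A))) where
  exists_subset_inter := by
    rintro _ ⟨a, rfl⟩ _ ⟨b, rfl⟩ P hP
    have h : ∀ Q : PrimeIdeal A, Q ∈ basicN (a ⊼ₛ b) ↔ Q ∈ basicN a ∩ basicN b := fun Q => by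
      simp only [Set.mem_inter_iff, mem_basicN, Q.mem_meet_iff, not_or]
    exact ⟨_, ⟨a ⊼ₛ b, rfl⟩, (h P).2 hP, fun Q => (h Q).1⟩
  sUnion_eq := by
    refine Set.eq_univ_of_forall fun P => ?_
    obtain ⟨a, ha⟩ := P.exists_notMem
    exact ⟨_, ⟨a, rfl⟩, ha⟩
  eq_generateFrom := rfl

/-- An ultrafilter `F` on `N_a` has as limit the set of the elements lying in `F`-almost every prime
ideal. An ultrafilter decides disjunctions, which makes this set prime, and `N_a ∈ F` keeps `a` out
of it. Deciding negations gives convergence. -/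
theorem isCompact_basicN (a : A) : IsCompact (basicN a) := by
  rw [isCompact_iff_ultrafilter_le_nhds]
  intro F hF
  let P : PrimeIdeal A :=
    { carrier := {b | ∀ᶠ Q in (F : Filter (PrimeIdeal A)), b ∈ Q.carrier}
      zero_mem := Filter.Eventually.of_forall fun Q => Q.zero_mem
      join_mem := fun hx hy => by
        filter_upwards [hx, hy] with Q h1 h2 using Q.join_mem h1 h2
      lower := fun h hy => by
        filter_upwards [hy] with Q hQ using Q.lower h hQ
      ne_univ := by
        intro h
        have h1 : ∀ᶠ Q in (F : Filter (PrimeIdeal A)), a ∈ Q.carrier := Set.eq_univ_iff_forall.1 h a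
        obtain ⟨Q, h2, h3⟩ := (h1.and (Filter.le_principal_iff.1 hF)).exists
        exact h3 h2
      prime := fun h =>
        Ultrafilter.eventually_or.1 (Filter.Eventually.mono h fun Q hQ => Q.prime hQ) }
  refine ⟨P, ?_, ?_⟩
  · intro h
    obtain ⟨Q, h2, h3⟩ := (Filter.Eventually.and h (Filter.le_principal_iff.1 hF)).exists
    exact h3 h2
  · rw [nhds_generateFrom, le_iInf₂_iff]
    rintro _ ⟨hP, b, rfl⟩
    rw [Filter.le_principal_iff]
    exact Ultrafilter.eventually_not.2 hP

/-- If `a` lies in `P` but not in `Q`, and `b` is outside `P`, then `N_{b ∖ a}` and `N_a` are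
disjoint neighbourhoods of `P` and `Q`. -/
instance : T2Space (PrimeIdeal A) := by
  have key : ∀ P Q : PrimeIdeal A, ∀ a ∈ P.carrier, a ∉ Q.carrier →
      ∃ u v : Set (PrimeIdeal A), IsOpen u ∧ IsOpen v ∧ P ∈ u ∧ Q ∈ v ∧ Disjoint u v := by
    intro P Q a hP hQ
    obtain ⟨b, hb⟩ := P.exists_notMem
    refine ⟨_, _, isOpen_basicN (b ∖ₛ a), isOpen_basicN a, ?_, hQ, ?_⟩
    · rw [mem_basicN, P.mem_diff_iff]
      exact fun h => hb (h hP)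
    · rw [Set.disjoint_left]
      intro R h1 h2
      rw [mem_basicN, R.mem_diff_iff] at h1
      exact h1 fun h => (h2 h).elim
  refine ⟨fun P Q hPQ => ?_⟩
  by_cases h : ∃ a ∈ P.carrier, a ∉ Q.carrier
  · obtain ⟨a, h1, h2⟩ := h
    exact key P Q a h1 h2
  · have h' : ∃ a ∈ Q.carrier, a ∉ P.carrier := by
      by_contra hcon
      push Not at h hcon
      exact hPQ (PrimeIdeal.ext (Set.Subset.antisymm h hcon))
    obtain ⟨a, h1, h2⟩ := h'
    obtain ⟨u, v, hu, hv, h3, h4, h5⟩ := key Q P a h1 h2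
    exact ⟨v, u, hv, hu, h4, h3, h5.symm⟩

theorem isBooleanSpace_primeIdeal (A : RSkewAlg.{u}) : IsBooleanSpace (PrimeIdeal A) :=
  isBooleanSpace_of_basis isTopologicalBasis_basicN
    (by rintro _ ⟨a, rfl⟩; exact isCompact_basicN a)

/-! ## The skew spectrum -/

namespace SkewSpectrum

theorem mem_cls_mk' {P : PrimeIdeal A} {t : A} {ht : t ∉ P.carrier} {a : A} :
    a ∈ (mk' P t ht).cls ↔ a ∩ₛ t ∉ P.carrier := PrimeIdeal.theta_iff ht

theorem self_mem_cls_mk' {P : PrimeIdeal A} {t : A} {ht : t ∉ P.carrier} :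
    t ∈ (mk' P t ht).cls := by
  rwa [mem_cls_mk', inter_eq_of_natLe (NatLe.refl t)]

variable {x y : SkewSpectrum A} {a b : A}

theorem exists_eq_mk' (x : SkewSpectrum A) : ∃ (t : A) (h : t ∉ x.ideal.carrier),
    x = mk' x.ideal t h := by
  obtain ⟨t, ht, h⟩ := x.exists_rep
  exact ⟨t, ht, SkewSpectrum.ext rfl h⟩

theorem exists_mem_cls (x : SkewSpectrum A) : ∃ t, t ∈ x.cls := by
  obtain ⟨t, ht, h⟩ := x.exists_eq_mk'
  exact ⟨t, by rw [h]; exact self_mem_cls_mk'⟩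

theorem notMem_of_mem_cls (h : a ∈ x.cls) : a ∉ x.ideal.carrier := by
  obtain ⟨t, ht, hx⟩ := x.exists_eq_mk'
  rw [hx, mem_cls_mk'] at h
  exact fun ha => h (x.ideal.mem_of_natLe (inter_le_left _ _) ha)

/-- Any member of the class may serve as its representative, so later arguments never return to the
chosen one. -/
theorem mem_cls_iff (hb : b ∈ x.cls) : a ∈ x.cls ↔ a ∩ₛ b ∉ x.ideal.carrier := by
  obtain ⟨t, ht, hx⟩ := x.exists_eq_mk'
  have h1 : x.ideal.Rel b t := PrimeIdeal.theta_iff_rel.1 (by rw [hx] at hb; exact hb)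
  have h2 : a ∈ x.cls ↔ x.ideal.Rel a t :=
    Iff.trans (by rw [hx]; exact Iff.rfl) PrimeIdeal.theta_iff_rel
  rw [← PrimeIdeal.theta_iff (notMem_of_mem_cls hb), PrimeIdeal.theta_iff_rel, h2]
  exact ⟨fun h => h.trans h1.symm, fun h => h.trans h1⟩

theorem mem_cls_of_natLe (h : NatLe a b) (hb : b ∈ x.cls) : a ∈ x.cls ↔ a ∉ x.ideal.carrier := by
  rw [mem_cls_iff hb, inter_eq_of_natLe h]

theorem mem_cls_of_natLe' (h : NatLe a b) (ha : a ∈ x.cls) : b ∈ x.cls := by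
  rw [mem_cls_iff ha, inter_comm, inter_eq_of_natLe h]
  exact notMem_of_mem_cls ha

/-- Read `a ∈ x.cls` as "the section `a` passes through `x`" and `a ∉ x.ideal.carrier` as "`a` is
defined at the base point of `x`". This rule and the next three are then the formulas for the
operations on copen sections, and make `a ↦ M_a` a homomorphism. -/
theorem inter_mem_cls_iff : a ∩ₛ b ∈ x.cls ↔ a ∈ x.cls ∧ b ∈ x.cls := by
  constructor
  · exact fun h => ⟨mem_cls_of_natLe' (inter_le_left _ _) h,
      mem_cls_of_natLe' (inter_le_right _ _) h⟩
  · rintro ⟨ha, hb⟩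
    rw [mem_cls_of_natLe (inter_le_left _ _) ha, ← mem_cls_iff hb]
    exact ha

theorem meet_mem_cls_iff : a ⊼ₛ b ∈ x.cls ↔ a ∉ x.ideal.carrier ∧ b ∈ x.cls := by
  constructor
  · intro h
    refine ⟨fun ha => notMem_of_mem_cls h (x.ideal.mem_meet_iff.2 (Or.inl ha)),
      mem_cls_of_natLe' (meet_natLe_right _ _) h⟩
  · rintro ⟨ha, hb⟩
    rw [mem_cls_of_natLe (meet_natLe_right a b) hb, x.ideal.mem_meet_iff]
    exact fun h => h.elim ha (notMem_of_mem_cls hb)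

theorem diff_mem_cls_iff : a ∖ₛ b ∈ x.cls ↔ a ∈ x.cls ∧ b ∈ x.ideal.carrier := by
  constructor
  · intro h
    have h1 := notMem_of_mem_cls h
    rw [x.ideal.mem_diff_iff, Classical.not_imp] at h1
    exact ⟨mem_cls_of_natLe' (diff_le a b) h, h1.1⟩
  · rintro ⟨ha, hb⟩
    rw [mem_cls_of_natLe (diff_le a b) ha, x.ideal.mem_diff_iff]
    exact fun h => notMem_of_mem_cls ha (h hb)

theorem join_mem_cls_iff :
    a ⊻ₛ b ∈ x.cls ↔ a ∈ x.cls ∨ (b ∈ x.cls ∧ a ∈ x.ideal.carrier) := by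
  by_cases ha : a ∈ x.ideal.carrier
  -- With `a ∈ P`, the join and `b` have the common lower bound `b ∖ₛ a`, which represents `b` near
  -- `x`.
  · have hle : NatLe (b ∖ₛ a) (a ⊻ₛ b) := natLe_join_right (diff_le b a) (diff_meet_right b a)
    constructor
    · intro h
      have h1 := notMem_of_mem_cls h
      rw [x.ideal.mem_join_iff] at h1
      refine Or.inr ⟨(diff_mem_cls_iff (b := a).1 ?_).1, ha⟩
      rw [mem_cls_of_natLe hle h, x.ideal.mem_diff_iff]
      exact fun h2 => h1 ⟨ha, h2 ha⟩
    · rintro (h | h)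
      · exact (notMem_of_mem_cls h ha).elim
      · exact mem_cls_of_natLe' hle (diff_mem_cls_iff.2 h)
  · constructor
    · intro h
      exact Or.inl ((mem_cls_of_natLe (natLe_join_left a b) h).2 ha)
    · rintro (h | h)
      · exact mem_cls_of_natLe' (natLe_join_left a b) h
      · exact (ha h.2).elim

theorem eq_mk' (h : a ∈ x.cls) : x = mk' x.ideal a (notMem_of_mem_cls h) := by
  refine SkewSpectrum.ext rfl (Set.ext fun b => ?_)
  rw [mem_cls_iff h, mem_cls_mk']

theorem eq_of_ideal_eq (h : x.ideal = y.ideal) (hx : a ∈ x.cls) (hy : a ∈ y.cls) : x = y := by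
  refine SkewSpectrum.ext h (Set.ext fun b => ?_)
  rw [mem_cls_iff hx, mem_cls_iff hy, h]

/-- The class determines the ideal: with `t` in the class, `a` is outside the ideal exactly when `a
⊼ₛ t` is in the class. Points may therefore be compared through their classes alone. -/
theorem eq_of_cls_eq (h : x.cls = y.cls) : x = y := by
  obtain ⟨t, ht⟩ := x.exists_mem_cls
  have ht' : t ∈ y.cls := h ▸ ht
  refine eq_of_ideal_eq (PrimeIdeal.ext (Set.ext fun a => ?_)) ht ht'
  have h1 : a ⊼ₛ t ∈ x.cls ↔ a ⊼ₛ t ∈ y.cls := by rw [h]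
  rw [meet_mem_cls_iff, meet_mem_cls_iff] at h1
  tauto

theorem zero_notMem_cls : (0 : A) ∉ x.cls := fun h => notMem_of_mem_cls h x.ideal.zero_mem

end SkewSpectrum

open SkewSpectrum

theorem mem_basicM {a : A} {x : SkewSpectrum A} : x ∈ basicM a ↔ a ∈ x.cls := by
  constructor
  · rintro ⟨P, h, rfl⟩
    exact self_mem_cls_mk'
  · exact fun h => ⟨_, _, eq_mk' h⟩

theorem isOpen_basicM (a : A) : IsOpen (basicM a) := isOpen_generateFrom_of_mem ⟨a, rfl⟩

/-- The intersection operation of the algebra is what closes the sets `M_a` under finite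
intersection: `M_a ∩ M_b = M_{a ∩ b}`. -/
theorem isTopologicalBasis_basicM : IsTopologicalBasis (Set.range (basicM (A := A))) where
  exists_subset_inter := by
    rintro _ ⟨a, rfl⟩ _ ⟨b, rfl⟩ x hx
    have h : ∀ y : SkewSpectrum A, y ∈ basicM (a ∩ₛ b) ↔ y ∈ basicM a ∩ basicM b := fun y => by
      simp only [Set.mem_inter_iff, mem_basicM, inter_mem_cls_iff]
    exact ⟨_, ⟨a ∩ₛ b, rfl⟩, (h x).2 hx, fun y => (h y).1⟩
  sUnion_eq := by
    refine Set.eq_univ_of_forall fun x => ?_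
    obtain ⟨a, ha⟩ := x.exists_mem_cls
    exact ⟨_, ⟨a, rfl⟩, mem_basicM.2 ha⟩
  eq_generateFrom := rfl

theorem image_specMap_basicM (a : A) : specMap A '' basicM a = basicN a := by
  ext P
  constructor
  · rintro ⟨x, hx, rfl⟩
    exact notMem_of_mem_cls (mem_basicM.1 hx)
  · exact fun h => ⟨mk' P a h, ⟨P, h, rfl⟩, rfl⟩

theorem injOn_specMap_basicM (a : A) : Set.InjOn (specMap A) (basicM a) :=
  fun _ hx _ hy h => eq_of_ideal_eq h (mem_basicM.1 hx) (mem_basicM.1 hy)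

theorem continuous_specMap : Continuous (specMap A) := by
  refine continuous_generateFrom_iff.2 ?_
  rintro _ ⟨a, rfl⟩
  -- Some section `b` passes through any point over `N_a`, and `a ⊼ₛ b` is `b` restricted to the
  -- support of `a`.
  have h : specMap A ⁻¹' basicN a = ⋃ b : A, basicM (a ⊼ₛ b) := by
    ext x
    simp only [Set.mem_iUnion, mem_basicM, meet_mem_cls_iff, exists_and_left]
    exact ⟨fun h => ⟨h, x.exists_mem_cls⟩, fun h => h.1⟩
  rw [h]
  exact isOpen_iUnion fun b => isOpen_basicM _

theorem isOpenMap_specMap : IsOpenMap (specMap A) := by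
  rw [isTopologicalBasis_basicM.isOpenMap_iff]
  rintro _ ⟨a, rfl⟩
  rw [image_specMap_basicM]
  exact isOpen_basicN a

theorem isOpenEmbedding_restrict_specMap (a : A) :
    IsOpenEmbedding ((basicM a).domRestrict (specMap A)) :=
  .of_continuous_injective_isOpenMap (continuous_specMap.comp continuous_subtype_val)
    (Set.injOn_iff_injective.1 (injOn_specMap_basicM a))
    (isOpenMap_specMap.comp (isOpen_basicM a).isOpenMap_subtype_val)

theorem isLocalHomeomorph_specMap : IsLocalHomeomorph (specMap A) := by
  rw [isLocalHomeomorph_iff_isOpenEmbedding_restrict]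
  intro x
  obtain ⟨a, ha⟩ := x.exists_mem_cls
  exact ⟨basicM a, (isOpen_basicM a).mem_nhds (mem_basicM.2 ha),
    isOpenEmbedding_restrict_specMap a⟩

/-- The projection maps `M_a` homeomorphically onto `N_a`, so compactness is inherited from the
spectrum. -/
theorem isCompact_basicM (a : A) : IsCompact (basicM a) := by
  rw [isCompact_iff_isCompact_univ,
    (isOpenEmbedding_restrict_specMap a).isInducing.isCompact_iff, Set.image_univ,
    Set.range_domRestrict, image_specMap_basicM]
  exact isCompact_basicN a

/-- Points over different primes are separated in the spectrum. Over one prime `P`, distinct classes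
with members `s` and `t` have `s ∩ₛ t ∈ P`, so removing it from `s` keeps the section through `x`
and makes its basic set disjoint from `M_t`. -/
instance : T2Space (SkewSpectrum A) := by
  refine ⟨fun x y hxy => ?_⟩
  by_cases h : x.ideal = y.ideal
  · obtain ⟨s, hs⟩ := x.exists_mem_cls
    obtain ⟨t, ht⟩ := y.exists_mem_cls
    have hst : s ∩ₛ t ∈ x.ideal.carrier := by
      by_contra hst
      rw [h, ← mem_cls_iff ht] at hst
      exact hxy (eq_of_ideal_eq h hs hst)
    refine ⟨_, _, isOpen_basicM (s ∖ₛ (s ∩ₛ t)), isOpen_basicM t,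
      mem_basicM.2 (diff_mem_cls_iff.2 ⟨hs, hst⟩), mem_basicM.2 ht, ?_⟩
    rw [Set.disjoint_left]
    intro z h1 h2
    rw [mem_basicM] at h1 h2
    rw [diff_mem_cls_iff] at h1
    exact notMem_of_mem_cls (inter_mem_cls_iff.2 ⟨h1.1, h2⟩) h1.2
  · exact separated_by_continuous continuous_specMap h

theorem isSkewBooleanSpace_specMap (A : RSkewAlg.{u}) : IsSkewBooleanSpace (specMap A) :=
  ⟨isBooleanSpace_of_basis isTopologicalBasis_basicM
      (by rintro _ ⟨a, rfl⟩; exact isCompact_basicM a),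
    isBooleanSpace_primeIdeal A, isLocalHomeomorph_specMap,
    fun P => by obtain ⟨a, ha⟩ := P.exists_notMem; exact ⟨mk' P a ha, rfl⟩⟩

/-! ## Functoriality of the skew spectrum -/

section maps

variable {A' : RSkewAlg.{u}} (f : SkewHom A A')

theorem mem_downMap {P : PrimeIdeal A'} {Q : PrimeIdeal A} :
    Q ∈ downMap f P ↔ ∀ a, a ∈ Q.carrier ↔ f.toFun a ∈ P.carrier := by
  constructor
  · rintro ⟨h, rfl⟩ a
    exact Iff.rfl
  · intro h
    obtain ⟨a, ha⟩ := Q.exists_notMem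
    exact ⟨⟨a, fun h' => ha ((h a).2 h')⟩, PrimeIdeal.ext (Set.ext fun b => (h b).symm)⟩

theorem mem_cls_comap {P : PrimeIdeal A'} {a b : A} (h : f.toFun a ∉ P.carrier) :
    b ∈ (mk' (P.comap f a h) a h).cls ↔ f.toFun b ∈ (mk' P (f.toFun a) h).cls := by
  refine mem_cls_mk'.trans (Iff.trans ?_ mem_cls_mk'.symm)
  rw [← f.map_inter]
  exact Iff.rfl

/-- The value at `x` is the point whose class is the inverse image of the class of `x`. This removes
the choice of `a` made in the definition and reduces functoriality to that of inverse images. -/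
theorem mem_upMap {x : SkewSpectrum A'} {y : SkewSpectrum A} :
    y ∈ upMap f x ↔ ∀ a, a ∈ y.cls ↔ f.toFun a ∈ x.cls := by
  have key : ∀ z ∈ upMap f x, ∀ a, a ∈ z.cls ↔ f.toFun a ∈ x.cls := by
    rintro z ⟨h, rfl⟩ b
    have h1 := mem_cls_comap f (b := b) h.choose_spec.choose
    rwa [← h.choose_spec.choose_spec] at h1
  refine ⟨key y, fun h => ?_⟩
  obtain ⟨a, ha⟩ := y.exists_mem_cls
  have hdom : (upMap f x).Dom := ⟨a, _, eq_mk' ((h a).1 ha)⟩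
  have hz := key _ (Part.get_mem hdom)
  rw [eq_of_cls_eq (x := y) (y := (upMap f x).get hdom) (Set.ext fun b => (h b).trans (hz b).symm)]
  exact Part.get_mem hdom

theorem mk'_mem_upMap {x : SkewSpectrum A'} {a : A} (h : f.toFun a ∈ x.cls) :
    mk' (x.ideal.comap f a (notMem_of_mem_cls h)) a (notMem_of_mem_cls h) ∈ upMap f x := by
  refine (mem_upMap f).2 fun b => ?_
  rw [mem_cls_comap, ← eq_mk' h]

theorem comap_mem_downMap {P : PrimeIdeal A'} {a : A} (h : f.toFun a ∉ P.carrier) :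
    P.comap f a h ∈ downMap f P := (mem_downMap f).2 fun _ => Iff.rfl

/-- Since `M_{f a}` is compact and open, this gives continuity and properness of `f^↑`; it is also
the naturality of `a ↦ M_a`. -/
theorem preimage_upMap_basicM (a : A) : (upMap f).preimage (basicM a) = basicM (f.toFun a) := by
  ext x
  rw [PFun.mem_preimage, mem_basicM]
  constructor
  · rintro ⟨y, hy, hyx⟩
    exact ((mem_upMap f).1 hyx a).1 (mem_basicM.1 hy)
  · exact fun h => ⟨_, mem_basicM.2 self_mem_cls_mk', mk'_mem_upMap f h⟩

theorem preimage_downMap_basicN (a : A) :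
    (downMap f).preimage (basicN a) = basicN (f.toFun a) := by
  ext P
  rw [PFun.mem_preimage, mem_basicN]
  constructor
  · rintro ⟨Q, hQ, hQP⟩
    exact fun h => hQ (((mem_downMap f).1 hQP a).2 h)
  · exact fun h => ⟨_, h, comap_mem_downMap f h⟩

theorem isSkewMorphism_upMap : IsSkewMorphism (specMap A') (specMap A) (upMap f) (downMap f) where
  proper_top := by
    refine isProperPartial_of_basis isTopologicalBasis_basicM ?_ ?_ <;> rintro _ ⟨a, rfl⟩ <;>
      rw [preimage_upMap_basicM]
    exacts [isOpen_basicM _, isCompact_basicM _]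
  proper_base := by
    refine isProperPartial_of_basis isTopologicalBasis_basicN ?_ ?_ <;> rintro _ ⟨a, rfl⟩ <;>
      rw [preimage_downMap_basicN]
    exacts [isOpen_basicN _, isCompact_basicN _]
  image_dom := by
    ext P
    constructor
    · rintro ⟨x, ⟨a, h, -⟩, rfl⟩
      exact ⟨a, h⟩
    · rintro ⟨a, h⟩
      exact ⟨mk' P (f.toFun a) h, ⟨a, h, rfl⟩, rfl⟩
  comm := by
    intro x y hy
    obtain ⟨a, ha⟩ := y.exists_mem_cls
    have hax := ((mem_upMap f).1 hy a).1 ha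
    rw [Part.mem_unique hy (mk'_mem_upMap f hax)]
    exact comap_mem_downMap f (notMem_of_mem_cls hax)
  fiber := by
    intro P y hy
    obtain ⟨a, ha⟩ := y.exists_mem_cls
    have hP : f.toFun a ∉ P.carrier := fun h =>
      notMem_of_mem_cls ha (((mem_downMap f).1 hy a).2 h)
    -- A point over `P` that is sent to `y` has `f a` in its class, so it can only be `P_{f(a)}`.
    refine ⟨mk' P (f.toFun a) hP, ⟨rfl, ?_⟩, ?_⟩
    · have h : y = mk' (P.comap f a hP) a hP :=
        eq_of_ideal_eq (a := a) (Part.mem_unique hy (comap_mem_downMap f hP)) ha self_mem_cls_mk'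
      rw [h]
      exact mk'_mem_upMap f (x := mk' P (f.toFun a) hP) self_mem_cls_mk'
    · rintro x ⟨rfl, hx⟩
      exact eq_mk' (((mem_upMap f).1 hx a).1 ha)

end maps

theorem spectrumIsFunctor : SpectrumIsFunctor.{u} where
  isSkew := isSkewBooleanSpace_specMap
  isMor f := isSkewMorphism_upMap f
  upMap_apply f P a h := mk'_mem_upMap f (x := mk' P (SkewHom.toFun f a) h) self_mem_cls_mk'
  upMap_id A := PFun.ext fun x y => by
    rw [mem_upMap, mem_id]
    exact ⟨fun h => eq_of_cls_eq (Set.ext h), fun h a => by rw [h, id_toFun]⟩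
  downMap_id A := PFun.ext fun x y => by
    rw [mem_downMap, mem_id]
    exact ⟨fun h => PrimeIdeal.ext (Set.ext h), fun h a => by rw [h, id_toFun]⟩
  upMap_comp f g := PFun.ext fun x z => by
    rw [mem_upMap, mem_comp]
    constructor
    · intro h
      obtain ⟨a, ha⟩ := z.exists_mem_cls
      have hy := mk'_mem_upMap g ((h a).1 ha)
      exact ⟨_, hy, (mem_upMap f).2 fun b => (h b).trans ((mem_upMap g).1 hy _).symm⟩
    · rintro ⟨y, hy, hz⟩ a
      exact ((mem_upMap f).1 hz a).trans ((mem_upMap g).1 hy _)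
  downMap_comp f g := PFun.ext fun P R => by
    rw [mem_downMap, mem_comp]
    constructor
    · intro h
      obtain ⟨a, ha⟩ := R.exists_notMem
      have hQ := comap_mem_downMap g (mt (h a).2 ha)
      exact ⟨_, hQ, (mem_downMap f).2 fun b => (h b).trans ((mem_downMap g).1 hQ _).symm⟩
    · rintro ⟨Q, hQ, hR⟩ a
      exact ((mem_downMap f).1 hR a).trans ((mem_downMap g).1 hQ _)

/-! ## The copen sections of the skew spectrum -/

/-- A bijective homomorphism is an isomorphism. -/
noncomputable def isoOfBijective {A B : RSkewAlg.{u}} (f : A ⟶ B)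
    (hf : Function.Bijective (SkewHom.toFun f)) : A ≅ B :=
  have hs := (Equiv.ofBijective _ hf).apply_symm_apply
  { hom := f
    inv := SkewHom.mk (Equiv.ofBijective _ hf).symm
      (hf.1 ((hs _).trans (SkewHom.map_zero f).symm))
      (fun _ _ => hf.1 ((hs _).trans (Eq.symm
        ((SkewHom.map_meet f _ _).trans (congrArg₂ (· ⊼ₛ ·) (hs _) (hs _))))))
      (fun _ _ => hf.1 ((hs _).trans (Eq.symm
        ((SkewHom.map_join f _ _).trans (congrArg₂ (· ⊻ₛ ·) (hs _) (hs _))))))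
      (fun _ _ => hf.1 ((hs _).trans (Eq.symm
        ((SkewHom.map_diff f _ _).trans (congrArg₂ (· ∖ₛ ·) (hs _) (hs _))))))
      (fun _ _ => hf.1 ((hs _).trans (Eq.symm
        ((SkewHom.map_inter f _ _).trans (congrArg₂ (· ∩ₛ ·) (hs _) (hs _))))))
    hom_inv_id := SkewHom.ext (funext (Equiv.ofBijective _ hf).symm_apply_apply)
    inv_hom_id := SkewHom.ext (funext hs) }

/-- The skew Boolean space of a right-handed skew algebra. -/
abbrev Spec (A : RSkewAlg.{u}) : SkewBoolSp.{u} := spectrumObj spectrumIsFunctor A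

section

variable {A : RSkewAlg.{u}}

theorem mem_sat_basicM {a : A} {x : SkewSpectrum A} :
    x ∈ sat (specMap A) (basicM a) ↔ a ∉ x.ideal.carrier := by
  rw [sat, image_specMap_basicM]
  exact Iff.rfl

/-- The basic open set `M_a` as a copen section. -/
def basicSection (a : A) : CopenSection (Spec A) :=
  ⟨basicM a, isOpen_basicM a, isCompact_basicM a, injOn_specMap_basicM a⟩

theorem basicSection_ext {a : A} {S : CopenSection (Spec A)}
    (h : ∀ x : SkewSpectrum A, a ∈ x.cls ↔ x ∈ S.carrier) : basicSection a = S :=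
  CopenSection.ext (Set.ext fun x => mem_basicM.trans (h x))

variable (A) in
/-- The homomorphism `a ↦ M_a`. -/
def basicHom : A ⟶ sectionAlg (Spec A) :=
  SkewHom.mk (A := A) (B := sectionAlg (Spec A)) basicSection
    (basicSection_ext fun _ => iff_of_false zero_notMem_cls fun h => h)
    (fun a b => basicSection_ext fun x => by
      rw [meet_mem_cls_iff, ← mem_sat_basicM, ← mem_basicM]
      exact Iff.rfl)
    (fun a b => basicSection_ext fun x => by
      rw [join_mem_cls_iff, ← not_not (a := a ∈ x.ideal.carrier), ← mem_sat_basicM, ← mem_basicM,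
        ← mem_basicM]
      exact Iff.rfl)
    (fun a b => basicSection_ext fun x => by
      rw [diff_mem_cls_iff, ← not_not (a := b ∈ x.ideal.carrier), ← mem_sat_basicM, ← mem_basicM]
      exact Iff.rfl)
    (fun a b => basicSection_ext fun x => by
      rw [inter_mem_cls_iff, ← mem_basicM, ← mem_basicM]
      exact Iff.rfl)

/-- If `a ≤ b` fails, then `a ∖ₛ (a ∩ₛ b)` is nonzero and some prime ideal `P` avoids it. Then `a ∩ₛ
b ∈ P` and `a ∉ P`, so the point `P_a` lies in `M_a` but not in `M_b`. -/
theorem natLe_of_basicM_subset {a b : A} (h : basicM a ⊆ basicM b) : NatLe a b := by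
  by_contra hab
  have hc : a ∖ₛ (a ∩ₛ b) ≠ 0 := by
    intro h0
    have h1 := diff_join a (a ∩ₛ b)
    rw [h0, zero_join, (inter_le_left a b).2, (inter_le_left a b).1] at h1
    exact hab (h1 ▸ inter_le_right a b)
  obtain ⟨P, hP⟩ := exists_prime_notMem hc
  rw [P.mem_diff_iff, Classical.not_imp] at hP
  have h1 := mem_basicM.1 (h (mem_basicM.2 (self_mem_cls_mk' (P := P) (ht := hP.2))))
  rw [mem_cls_mk', inter_comm] at h1
  exact h1 hP.1

/-- Injectivity is the reflection of the order. For surjectivity, compactness covers `S` by finitely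
many sets `M_a` contained in `S`, and joins realize their unions. The induction must keep every
`M_a` inside `S`, since unions and joins agree only where the projection is injective. -/
theorem basicSection_bijective : Function.Bijective (basicSection (A := A)) := by
  constructor
  · intro a b h
    have h' : basicM a = basicM b := congrArg CopenSection.carrier h
    exact (natLe_of_basicM_subset h'.subset).antisymm (natLe_of_basicM_subset h'.superset)
  · intro S
    obtain ⟨a, h1, h2⟩ : ∃ a : A, S.carrier ⊆ basicM a ∧ basicM a ⊆ S.carrier := by
      refine S.isCompact.induction_on (p := fun K => ∃ a : A, K ⊆ basicM a ∧ basicM a ⊆ S.carrier)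
        ⟨0, Set.empty_subset _, fun x hx => (zero_notMem_cls (mem_basicM.1 hx)).elim⟩
        (fun s t hst ⟨a, ha, ha'⟩ => ⟨a, hst.trans ha, ha'⟩) ?_ ?_
      · rintro s t ⟨a, ha, ha'⟩ ⟨b, hb, hb'⟩
        have h : basicM (a ⊻ₛ b) = basicM a ∪ basicM b := by
          ext x
          rw [Set.mem_union, mem_basicM, mem_basicM, mem_basicM, join_mem_cls_iff]
          constructor
          · exact fun h => h.imp_right And.left
          · rintro (h | h)
            · exact Or.inl h
            -- The join drops the points of `M_b` over the support of `a`. Such a point has a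
            -- companion in `M_a` in the same fibre, and injectivity on `S` makes the two equal, so
            -- nothing is lost.
            · by_cases hx : a ∈ x.ideal.carrier
              · exact Or.inr ⟨h, hx⟩
              · obtain ⟨y, hy, hyx⟩ := mem_sat_basicM.2 hx
                have : y = x := S.injOn (ha' hy) (hb' (mem_basicM.2 h)) hyx
                exact Or.inl (mem_basicM.1 (this ▸ hy))
        exact ⟨a ⊻ₛ b, h ▸ Set.union_subset_union ha hb, h ▸ Set.union_subset ha' hb'⟩
      · intro x hx
        obtain ⟨_, ⟨a, rfl⟩, hxa, haS⟩ :=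
          isTopologicalBasis_basicM.exists_subset_of_mem_open hx S.isOpen
        exact ⟨basicM a, mem_nhdsWithin_of_mem_nhds ((isOpen_basicM a).mem_nhds hxa), a,
          subset_rfl, haS⟩
    exact ⟨a, CopenSection.ext (h2.antisymm h1)⟩

variable (A) in
/-- A right-handed skew algebra is isomorphic to the algebra of copen sections of its skew
spectrum. -/
noncomputable def basicIso : A ≅ sectionAlg (Spec A) :=
  isoOfBijective (basicHom A) basicSection_bijective

end

/-! ## The skew spectrum of the algebra of copen sections -/

section

variable {X : SkewBoolSp.{u}}

/-- A compact open neighbourhood inside the source of a chart of `X.p` is a copen section. These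
form a basis of the total space, and their images form one of the base. -/
theorem exists_copenSection {e : X.E} {U : Set X.E} (hU : IsOpen U) (he : e ∈ U) :
    ∃ S : CopenSection X, e ∈ S.carrier ∧ S.carrier ⊆ U := by
  obtain ⟨φ, hφ, hp⟩ := X.isSkew.2.2.1 e
  obtain ⟨V, h1, h2, h3, h4⟩ :=
    X.isSkew.1.exists_compactOpen (hU.inter φ.open_source) ⟨he, hφ⟩
  refine ⟨⟨V, h1, h2, ?_⟩, h3, h4.trans Set.inter_subset_left⟩
  rw [hp]
  exact φ.injOn.mono (h4.trans Set.inter_subset_right)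

theorem isTopologicalBasis_copenSection :
    IsTopologicalBasis (Set.range (CopenSection.carrier (X := X))) := by
  refine isTopologicalBasis_of_isOpen_of_nhds (by rintro _ ⟨S, rfl⟩; exact S.isOpen) ?_
  intro e U he hU
  obtain ⟨S, h1, h2⟩ := exists_copenSection hU he
  exact ⟨_, ⟨S, rfl⟩, h1, h2⟩

theorem isTopologicalBasis_image_copenSection :
    IsTopologicalBasis (Set.range fun S : CopenSection X => X.p '' S.carrier) := by
  refine isTopologicalBasis_of_isOpen_of_nhds
    (by rintro _ ⟨S, rfl⟩; exact X.isSkew.2.2.1.isOpenMap _ S.isOpen) ?_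
  intro b U hb hU
  obtain ⟨e, rfl⟩ := X.isSkew.2.2.2 b
  obtain ⟨S, h1, h2⟩ := exists_copenSection (hU.preimage X.isSkew.2.2.1.continuous) hb
  exact ⟨_, ⟨S, rfl⟩, ⟨e, h1, rfl⟩, Set.image_subset_iff.2 h2⟩

/-- The prime ideal of the copen sections that are not defined at `b`. -/
def basePoint (b : X.B) : PrimeIdeal (sectionAlg X) where
  carrier := {S : CopenSection X | b ∉ X.p '' S.carrier}
  zero_mem := by
    rintro ⟨e, he, -⟩
    exact he
  join_mem := by
    rintro S R hS hR ⟨e, he | he, rfl⟩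
    · exact hS ⟨e, he, rfl⟩
    · exact hR ⟨e, he.1, rfl⟩
  lower := by
    rintro S R h hR ⟨e, he, rfl⟩
    have h1 : S = secMeet R S := (natPre_iff.1 h).symm
    rw [h1] at he
    exact hR he.1
  ne_univ := by
    intro h
    obtain ⟨e, rfl⟩ := X.isSkew.2.2.2 b
    obtain ⟨S, h1, -⟩ := exists_copenSection isOpen_univ (Set.mem_univ e)
    exact Set.eq_univ_iff_forall.1 h S ⟨e, h1, rfl⟩
  prime := by
    intro S R h
    by_contra hcon
    rw [not_or] at hcon
    obtain ⟨e, he, hb⟩ := not_not.1 hcon.1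
    obtain ⟨e', he', hb'⟩ := not_not.1 hcon.2
    exact h ⟨e', ⟨⟨e, he, hb.trans hb'.symm⟩, he'⟩, hb'⟩

theorem notMem_basePoint {b : X.B} {S : CopenSection X} :
    S ∉ (basePoint b).carrier ↔ b ∈ X.p '' S.carrier := not_not

theorem exists_copenSection_mem (e : X.E) : ∃ S : CopenSection X, e ∈ S.carrier :=
  (exists_copenSection isOpen_univ (Set.mem_univ e)).imp fun _ h => h.1

/-- The point of the skew spectrum given by the copen sections through `e`. -/
noncomputable def topPoint (e : X.E) : SkewSpectrum (sectionAlg X) :=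
  mk' (basePoint (X.p e)) (exists_copenSection_mem e).choose
    (notMem_basePoint.2 ⟨e, (exists_copenSection_mem e).choose_spec, rfl⟩)

theorem mem_cls_mk'_basePoint {e : X.E} {S R : CopenSection X} (he : e ∈ R.carrier)
    (h : R ∉ (basePoint (X.p e)).carrier) :
    S ∈ (mk' (A := sectionAlg X) (basePoint (X.p e)) R h).cls ↔ e ∈ S.carrier := by
  refine (mem_cls_mk' (A := sectionAlg X)).trans (notMem_basePoint.trans ?_)
  constructor
  · rintro ⟨e', he', h'⟩
    exact R.injOn he'.2 he h' ▸ he'.1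
  · exact fun h => ⟨e, ⟨h, he⟩, rfl⟩

theorem mem_cls_topPoint {e : X.E} {S : CopenSection X} :
    S ∈ (topPoint e).cls ↔ e ∈ S.carrier :=
  mem_cls_mk'_basePoint (exists_copenSection_mem e).choose_spec _

/-- Fix `S ∉ Q`. If every point of `p(S)` were covered by some `p(R)` with `R ∈ Q`, then by
compactness a finite join in `Q` would cover `p(S)`, so `S` would precede it and lie in `Q`. Hence
some `b ∈ p(S)` is missed by all members of `Q`. -/
theorem basePoint_surjective : Function.Surjective (basePoint (X := X)) := by
  intro Q
  obtain ⟨S, hS⟩ := Q.exists_notMem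
  have hp : Continuous X.p := X.isSkew.2.2.1.continuous
  obtain ⟨b, hb, hbQ⟩ : ∃ b ∈ X.p '' S.carrier,
      ∀ R : CopenSection X, R ∈ Q.carrier → b ∉ X.p '' R.carrier := by
    by_contra hcon
    push Not at hcon
    obtain ⟨R, hR, hSR⟩ : ∃ R : CopenSection X, R ∈ Q.carrier ∧
        X.p '' S.carrier ⊆ X.p '' R.carrier := by
      refine (S.isCompact.image hp).induction_on
        (p := fun K => ∃ R : CopenSection X, R ∈ Q.carrier ∧ K ⊆ X.p '' R.carrier)
        ⟨0, Q.zero_mem, Set.empty_subset _⟩ (fun s t hst ⟨R, h1, h2⟩ => ⟨R, h1, hst.trans h2⟩) ?_ ?_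
      · rintro s t ⟨R, hR, hs⟩ ⟨T, hT, ht⟩
        refine ⟨R ⊻ₛ T, Q.join_mem hR hT, Set.union_subset (fun b hb => ?_) fun b hb => ?_⟩
        · obtain ⟨e, he, rfl⟩ := hs hb
          exact ⟨e, Or.inl he, rfl⟩
        · obtain ⟨e, he, rfl⟩ := ht hb
          by_cases h : e ∈ sat X.p R.carrier
          · obtain ⟨e', he', h'⟩ := h
            exact ⟨e', Or.inl he', h'⟩
          · exact ⟨e, Or.inr ⟨he, h⟩, rfl⟩
      · intro b hb
        obtain ⟨R, hR, hbR⟩ := hcon b hb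
        exact ⟨_, mem_nhdsWithin_of_mem_nhds
          ((X.isSkew.2.2.1.isOpenMap _ R.isOpen).mem_nhds hbR), R, hR, subset_rfl⟩
    refine hS (Q.lower (natPre_iff.2 (CopenSection.ext ?_)) hR)
    exact Set.inter_eq_right.2 fun e he => hSR ⟨e, he, rfl⟩
  refine ⟨b, PrimeIdeal.ext (Set.Subset.antisymm (fun R hR => ?_) fun R hR => hbQ R hR)⟩
  -- A section `R` outside `Q` that misses `b` is impossible: primality would put `S ∖ₛ R` in `Q`,
  -- although it is still defined at `b`.
  by_contra hRQ
  obtain ⟨e, he, rfl⟩ := hb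
  have h1 : S ∖ₛ R ∈ Q.carrier := Q.mem_diff_iff.2 fun h => (hRQ h).elim
  exact hbQ _ h1 ⟨e, ⟨he, fun ⟨e', he', h'⟩ => hR ⟨e', he', h'⟩⟩, rfl⟩

theorem topPoint_surjective : Function.Surjective (topPoint (X := X)) := by
  intro x
  obtain ⟨T, hT⟩ := x.exists_mem_cls
  obtain ⟨b, hb⟩ := basePoint_surjective x.ideal
  have hT' := notMem_of_mem_cls hT
  rw [← hb] at hT'
  obtain ⟨e, he, rfl⟩ := notMem_basePoint.1 hT'
  exact ⟨e, eq_of_ideal_eq hb (mem_cls_topPoint.2 he) hT⟩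

/-- A map from a `T0` space that pulls a basis back to a basis is an embedding. -/
theorem isEmbedding_of_basis {Y Z : Type u} [TopologicalSpace Y] [TopologicalSpace Z] [T0Space Y]
    {ι : Type u} {v : ι → Set Y} {w : ι → Set Z} (hv : IsTopologicalBasis (Set.range v))
    (hw : IsTopologicalBasis (Set.range w)) {φ : Y → Z} (h : ∀ i, φ ⁻¹' (w i) = v i) :
    IsEmbedding φ := by
  refine IsInducing.isEmbedding ⟨?_⟩
  rw [hv.eq_generateFrom, hw.eq_generateFrom, induced_generateFrom_eq, ← Set.range_comp]
  exact congrArg (fun f => generateFrom (Set.range f)) (funext fun i => (h i).symm)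

/-- The total space is homeomorphic to the skew spectrum. -/
noncomputable def topHomeo (X : SkewBoolSp.{u}) : X.E ≃ₜ SkewSpectrum (sectionAlg X) :=
  have : T2Space X.E := X.isSkew.1.2.1
  (isEmbedding_of_basis isTopologicalBasis_copenSection
    (isTopologicalBasis_basicM (A := sectionAlg X)) (φ := topPoint)
    fun _ => Set.ext fun _ => mem_basicM.trans mem_cls_topPoint).toHomeomorphOfSurjective
      topPoint_surjective

/-- The base space is homeomorphic to the spectrum. -/
noncomputable def baseHomeo (X : SkewBoolSp.{u}) : X.B ≃ₜ PrimeIdeal (sectionAlg X) :=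
  have : T2Space X.B := X.isSkew.2.1.2.1
  (isEmbedding_of_basis isTopologicalBasis_image_copenSection
    (isTopologicalBasis_basicN (A := sectionAlg X)) (φ := basePoint)
    fun _ => Set.ext fun _ => notMem_basePoint).toHomeomorphOfSurjective basePoint_surjective

end

/-! ## Isomorphisms from homeomorphisms -/

section

variable {E B E' B' : Type u} [TopologicalSpace E] [TopologicalSpace B] [TopologicalSpace E']
  [TopologicalSpace B']

theorem isProperPartial_homeo (φ : E ≃ₜ E') : IsProperPartial (PFun.lift φ) := by
  constructor
  · intro s hs
    rw [PFun.coe_preimage]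
    exact hs.preimage φ.continuous
  · intro K hK
    rw [PFun.coe_preimage]
    exact φ.isCompact_preimage.2 hK

theorem isSkewMorphism_homeo {p : E → B} {p' : E' → B'} (hp : Function.Surjective p)
    (φ : E ≃ₜ E') (ψ : B ≃ₜ B') (h : ∀ e, p' (φ e) = ψ (p e)) :
    IsSkewMorphism p p' (PFun.lift φ) (PFun.lift ψ) where
  proper_top := isProperPartial_homeo φ
  proper_base := isProperPartial_homeo ψ
  image_dom := by
    rw [show (PFun.lift φ).Dom = Set.univ from rfl, Set.image_univ, hp.range_eq]
    rfl
  comm e e' he := by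
    rw [PFun.lift, Part.mem_some_iff] at he
    rw [PFun.lift, Part.mem_some_iff, he, h]
  fiber x e' he := by
    have he := Part.mem_some_iff.1 he
    refine ⟨φ.symm e', ⟨ψ.injective ?_, ?_⟩, ?_⟩
    · rw [← h, φ.apply_symm_apply, he]
    · exact Part.mem_some_iff.2 (φ.apply_symm_apply e').symm
    · rintro y ⟨-, hy⟩
      rw [Part.mem_some_iff.1 hy, φ.symm_apply_apply]

end

/-- Homeomorphisms of the total and the base spaces that commute with the projections form an
isomorphism of skew Boolean spaces. -/
def isoOfHomeo {X Y : SkewBoolSp.{u}} (φ : X.E ≃ₜ Y.E) (ψ : X.B ≃ₜ Y.B)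
    (h : ∀ e, Y.p (φ e) = ψ (X.p e)) : X ≅ Y where
  hom := SpHom.mk (PFun.lift φ) (PFun.lift ψ) (isSkewMorphism_homeo X.isSkew.2.2.2 φ ψ h)
  inv := SpHom.mk (PFun.lift φ.symm) (PFun.lift ψ.symm)
    (isSkewMorphism_homeo Y.isSkew.2.2.2 φ.symm ψ.symm fun e => by
      rw [ψ.eq_symm_apply, ← h, φ.apply_symm_apply])
  hom_inv_id := SpHom.ext
    (PFun.ext fun x z => by
      refine (mem_comp _ _ _ _).trans (Iff.trans ?_ (mem_id x z).symm)
      simp)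
    (PFun.ext fun x z => by
      refine (mem_comp _ _ _ _).trans (Iff.trans ?_ (mem_id x z).symm)
      simp)
  inv_hom_id := SpHom.ext
    (PFun.ext fun x z => by
      refine (mem_comp _ _ _ _).trans (Iff.trans ?_ (mem_id x z).symm)
      simp)
    (PFun.ext fun x z => by
      refine (mem_comp _ _ _ _).trans (Iff.trans ?_ (mem_id x z).symm)
      simp)

/-- A skew Boolean space is isomorphic to the skew spectrum of its algebra of copen sections. -/
noncomputable def pointIso (X : SkewBoolSp.{u}) : X ≅ Spec (sectionAlg X) :=
  isoOfHomeo (Y := Spec (sectionAlg X)) (topHomeo X) (baseHomeo X) fun _ => rfl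

theorem mem_pointIso_top {X : SkewBoolSp.{u}} {e : X.E} {x : SkewSpectrum (sectionAlg X)} :
    x ∈ SpHom.top (pointIso X).hom e ↔ x = topPoint e := Part.mem_some_iff

theorem mem_pointIso_base {X : SkewBoolSp.{u}} {b : X.B} {P : PrimeIdeal (sectionAlg X)} :
    P ∈ SpHom.base (pointIso X).hom b ↔ P = basePoint b := Part.mem_some_iff

/-- Both composites send `e` to the germ of the sections `R` whose inverse image under `m` contains
`e`, that is, of the sections through the image of `e`. -/
theorem pointIso_naturality {X Y : SkewBoolSp.{u}} (m : X ⟶ Y) :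
    (pointIso X).hom ≫ (spectrumFunctor spectrumIsFunctor).map (sectionFunctor.map m.op).op =
      m ≫ (pointIso Y).hom := by
  refine SpHom.ext (PFun.ext fun e y => ?_) (PFun.ext fun b Q => ?_)
  · refine (mem_comp_top _ _ _ _).trans (Iff.trans ?_ (mem_comp_top _ _ _ _).symm)
    have h1 : ∀ x : SkewSpectrum (sectionAlg X), y ∈ upMap (sectionHom m) x ↔ _ :=
      fun x => mem_upMap (A := sectionAlg Y) (A' := sectionAlg X) (sectionHom m)
    constructor
    · rintro ⟨x, hx, hy⟩
      rw [mem_pointIso_top.1 hx] at hy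
      have hy := (h1 _).1 hy
      -- The class of `y` is nonempty, and any member `S` shows that `m` is defined at `e`.
      obtain ⟨S, hS⟩ := y.exists_mem_cls
      obtain ⟨e', -, he'⟩ := mem_cls_topPoint.1 ((hy S).1 hS)
      refine ⟨e', he', mem_pointIso_top.2 (eq_of_cls_eq (Set.ext fun R => ?_))⟩
      refine (hy R).trans (mem_cls_topPoint.trans (Iff.trans ?_ mem_cls_topPoint.symm))
      exact ⟨fun ⟨e'', h2, h3⟩ => Part.mem_unique h3 he' ▸ h2, fun h => ⟨e', h, he'⟩⟩
    · rintro ⟨e', he', hy⟩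
      refine ⟨topPoint e, mem_pointIso_top.2 rfl, (h1 _).2 fun R => ?_⟩
      rw [mem_pointIso_top.1 hy]
      refine mem_cls_topPoint.trans (Iff.trans ?_ mem_cls_topPoint.symm)
      exact ⟨fun h => ⟨e', h, he'⟩, fun ⟨e'', h2, h3⟩ => Part.mem_unique h3 he' ▸ h2⟩
  · refine (mem_comp_base _ _ _ _).trans (Iff.trans ?_ (mem_comp_base _ _ _ _).symm)
    have h1 : ∀ P : PrimeIdeal (sectionAlg X), Q ∈ downMap (sectionHom m) P ↔ _ :=
      fun x => mem_downMap (A := sectionAlg Y) (A' := sectionAlg X) (sectionHom m)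
    -- Where `m` is defined, a section `R` is defined at `b'` exactly when its inverse image is
    -- defined at `b`: the fibre condition lifts a point of `R`, and commutation of the square
    -- pushes one down.
    have h2 : ∀ b' ∈ SpHom.base m b, ∀ R : CopenSection Y,
        R ∈ (basePoint b').carrier ↔ secPreimage m R ∈ (basePoint b).carrier := by
      intro b' hb' R
      rw [← not_iff_not, notMem_basePoint, notMem_basePoint]
      constructor
      · rintro ⟨e', he', rfl⟩
        obtain ⟨e, ⟨h3, h4⟩, -⟩ := (SpHom.isMor m).fiber _ _ hb'
        exact ⟨e, ⟨e', he', h4⟩, h3⟩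
      · rintro ⟨e, ⟨e', he', he⟩, rfl⟩
        exact ⟨e', he', Part.mem_unique ((SpHom.isMor m).comm _ _ he) hb'⟩
    constructor
    · rintro ⟨P, hP, hQ⟩
      rw [mem_pointIso_base.1 hP] at hQ
      have hQ := (h1 _).1 hQ
      obtain ⟨S, hS⟩ := Q.exists_notMem
      obtain ⟨e, ⟨e', -, he'⟩, rfl⟩ := notMem_basePoint.1 (mt (hQ S).2 hS)
      have hb' := (SpHom.isMor m).comm _ _ he'
      exact ⟨_, hb', mem_pointIso_base.2
        (PrimeIdeal.ext (Set.ext fun R => (hQ R).trans (h2 _ hb' R).symm))⟩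
    · rintro ⟨b', hb', hQ⟩
      refine ⟨basePoint b, mem_pointIso_base.2 rfl, (h1 _).2 fun R => ?_⟩
      rw [mem_pointIso_base.1 hQ]
      exact h2 _ hb' R

/-! ## The duality -/

theorem basicHom_naturality {A A' : RSkewAlg.{u}} (f : A ⟶ A') :
    f ≫ basicHom A' = basicHom A ≫
      sectionFunctor.map ((spectrumFunctor spectrumIsFunctor).map f.op).op :=
  SkewHom.ext (funext fun a => CopenSection.ext (preimage_upMap_basicM f a).symm)

/-- The natural isomorphism between a skew Boolean space and its double dual. -/
noncomputable def pointNatIso : 𝟭 SkewBoolSp.{u}ᵒᵖ ≅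
    sectionFunctor ⋙ (spectrumFunctor spectrumIsFunctor).rightOp :=
  Iso.symm (NatIso.ofComponents (fun X => (pointIso X.unop).op)
    fun {_ _} f => Quiver.Hom.unop_inj (pointIso_naturality f.unop))

/-- The natural isomorphism between a right-handed skew algebra and its double dual. -/
noncomputable def basicNatIso :
    (spectrumFunctor spectrumIsFunctor).rightOp ⋙ sectionFunctor ≅ 𝟭 RSkewAlg.{u} :=
  Iso.symm (NatIso.ofComponents basicIso basicHom_naturality)

/-- The duality between skew Boolean spaces and right-handed skew algebras. -/
noncomputable def duality : SkewBoolSp.{u}ᵒᵖ ≌ RSkewAlg.{u} :=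
  CategoryTheory.Equivalence.mk sectionFunctor (spectrumFunctor spectrumIsFunctor).rightOp
    pointNatIso basicNatIso

/-! ## Open subsets and ideals -/

/-- An open set is the union of the copen sections it contains, so the ideal of these sections
determines it. -/
theorem idealOfOpen_le_iff {X : SkewBoolSp.{u}} {U V : Opens X.E} :
    idealOfOpen X U ≤ idealOfOpen X V ↔ U ≤ V := by
  constructor
  · intro h e he
    obtain ⟨S, h1, h2⟩ := exists_copenSection U.isOpen he
    exact h (show S ∈ (idealOfOpen X U).carrier from h2) h1
  · exact fun h S (hS : S.carrier ⊆ U) => hS.trans h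

/-- The union of the elements of an ideal of copen sections. -/
def openOfSections {X : SkewBoolSp.{u}} (I : LeIdeal (sectionAlg X)) : Opens X.E :=
  ⟨⋃ S ∈ I.carrier, CopenSection.carrier S, isOpen_biUnion fun S _ => CopenSection.isOpen S⟩

theorem mem_openOfSections {X : SkewBoolSp.{u}} {I : LeIdeal (sectionAlg X)} {e : X.E} :
    e ∈ openOfSections I ↔ ∃ S : CopenSection X, S ∈ I.carrier ∧ e ∈ S.carrier :=
  Set.mem_iUnion₂.trans (by simp only [exists_prop]; exact Iff.rfl)

/-- A copen section `T` covered by members of `I` is covered by finitely many sets `T ∩ S` with `S ∈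
I`, and these lie in `I` by downward closure. Being parts of the one section `T`, they have their
union as join, so `T` lies below a member of `I`. -/
theorem idealOfOpen_openOfSections {X : SkewBoolSp.{u}} (I : LeIdeal (sectionAlg X)) :
    idealOfOpen X (openOfSections I) = I := by
  refine LeIdeal.ext (Set.Subset.antisymm (fun (T : CopenSection X) hT => ?_) fun S hS e he =>
    mem_openOfSections.2 ⟨S, hS, he⟩)
  obtain ⟨R, hR, hTR, -⟩ : ∃ R : CopenSection X, R ∈ I.carrier ∧ T.carrier ⊆ R.carrier ∧
      R.carrier ⊆ T.carrier := by
    refine T.isCompact.induction_on (p := fun K => ∃ R : CopenSection X, R ∈ I.carrier ∧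
      K ⊆ R.carrier ∧ R.carrier ⊆ T.carrier)
      ⟨0, I.zero_mem, Set.empty_subset _, Set.empty_subset _⟩
      (fun s t hst ⟨R, h1, h2, h3⟩ => ⟨R, h1, hst.trans h2, h3⟩) ?_ ?_
    · rintro s t ⟨R, hR, hs, hRT⟩ ⟨S, hS, ht, hST⟩
      refine ⟨R ⊻ₛ S, I.join_mem hR hS, Set.union_subset (fun e he => Or.inl (hs he)) fun e he => ?_,
        Set.union_subset hRT (Set.sdiff_subset.trans hST)⟩
      by_cases h : e ∈ sat X.p R.carrier
      · obtain ⟨e', he', h'⟩ := h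
        exact Or.inl (T.injOn (hRT he') (hST (ht he)) h' ▸ he')
      · exact Or.inr ⟨ht he, h⟩
    · intro e he
      obtain ⟨S, hS, heS⟩ := mem_openOfSections.1 (hT he)
      exact ⟨_, mem_nhdsWithin_of_mem_nhds ((T ∩ₛ S).isOpen.mem_nhds ⟨he, heS⟩), T ∩ₛ S,
        I.lower (inter_le_right (A := sectionAlg X) T S) hS, subset_rfl, Set.inter_subset_left⟩
  exact I.lower ((natLe_iff _ _).2 hTR) hR

theorem LeIdeal.le_of_eq {A : Type u} [SkewAlgebra A] {I J : LeIdeal A} (h : I = J) : I ≤ J :=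
  (congrArg LeIdeal.carrier h).subset

theorem idealOfOpen_injective (X : SkewBoolSp.{u}) : Function.Injective (idealOfOpen X) :=
  fun _ _ h => le_antisymm (idealOfOpen_le_iff.1 (LeIdeal.le_of_eq h))
    (idealOfOpen_le_iff.1 (LeIdeal.le_of_eq h.symm))

theorem idealOfOpen_bijective (X : SkewBoolSp.{u}) : Function.Bijective (idealOfOpen X) :=
  ⟨idealOfOpen_injective X, fun I => ⟨_, idealOfOpen_openOfSections I⟩⟩

/-- An injective homomorphism whose image is a given ideal is the inclusion of this ideal up to an
isomorphism of the source. -/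
theorem exists_iso_of_range_eq {A' A : RSkewAlg.{u}} (f : A' ⟶ A) (I : LeIdeal A)
    (hf : Function.Injective (SkewHom.toFun f)) (hI : Set.range (SkewHom.toFun f) = I.carrier) :
    ∃ k : A' ≅ idealObj A I, f = k.hom ≫ idealIncl A I := by
  obtain ⟨J, k, hk⟩ := (leIdealInclusions_iff f).2 ⟨hf, fun x y h =>
    hI.superset (I.lower h (hI.subset ⟨y, rfl⟩))⟩
  have hJ : J = I := by
    refine LeIdeal.ext (Eq.trans ?_ hI)
    ext x
    constructor
    · intro hx
      refine ⟨SkewHom.toFun k.inv ⟨x, hx⟩, ?_⟩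
      rw [hk]
      exact congrArg Subtype.val (congrFun (congrArg SkewHom.toFun k.inv_hom_id) ⟨x, hx⟩)
    · rintro ⟨z, rfl⟩
      rw [hk]
      exact (SkewHom.toFun k.hom z).2
  subst hJ
  exact ⟨k, hk⟩

/-- Inverse image under the partial identity is direct image along the inclusion of `U`, which is
injective on sections and reaches exactly the sections contained in `U`. -/
theorem map_partialId (X : SkewBoolSp.{u}) (U : Opens X.E) :
    ∃ k : sectionAlg (restrictObj X U) ≅ idealObj (sectionAlg X) (idealOfOpen X U),
      sectionFunctor.map (partialId X U).op = k.hom ≫ idealIncl _ (idealOfOpen X U) := by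
  have h : ∀ S : CopenSection (restrictObj X U),
      (secPreimage (partialId X U) S).carrier = Subtype.val '' S.carrier :=
    fun S => preimage_partialIdMap _ _
  refine exists_iso_of_range_eq _ _ (fun S R hSR => CopenSection.ext ?_) (Set.Subset.antisymm ?_ ?_)
  · have h1 : (secPreimage (partialId X U) S).carrier = (secPreimage (partialId X U) R).carrier :=
      congrArg CopenSection.carrier hSR
    exact Subtype.val_injective.image_injective ((h S).symm.trans (h1.trans (h R)))
  · rintro _ ⟨S, rfl⟩
    refine (h S).subset.trans ?_
    rintro _ ⟨e, -, rfl⟩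
    exact e.2
  · intro (T : CopenSection X) (hT : T.carrier ⊆ U)
    have hT' : Subtype.val '' (Subtype.val ⁻¹' T.carrier : Set U) = T.carrier :=
      Set.Subset.antisymm (Set.image_preimage_subset _ _) fun e he => ⟨⟨e, hT he⟩, he, rfl⟩
    refine ⟨CopenSection.mk (X := restrictObj X U) (Subtype.val ⁻¹' T.carrier)
      (T.isOpen.preimage continuous_subtype_val) ?_ ?_, CopenSection.ext ((h _).trans hT')⟩
    · exact IsInducing.subtypeVal.isCompact_iff.2 ((congrArg IsCompact hT').mpr T.isCompact)
    · intro a ha b hb hab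
      exact Subtype.ext (T.injOn ha hb (congrArg Subtype.val hab))

/-! ## Partial identities and inclusions of ideals -/

theorem leIdealInclusions_of_isIso {A B : RSkewAlg.{u}} (f : A ⟶ B) [IsIso f] :
    leIdealInclusions f := by
  refine (leIdealInclusions_iff f).2 ⟨Function.LeftInverse.injective
    (g := SkewHom.toFun (inv f)) fun x => ?_, fun x y _ => ⟨SkewHom.toFun (inv f) x, ?_⟩⟩
  · rw [← comp_toFun, IsIso.hom_inv_id, id_toFun]
  · rw [← comp_toFun, IsIso.inv_hom_id, id_toFun]

theorem leIdealInclusions_comp_iso_iff {A B C : RSkewAlg.{u}} (f : A ⟶ B) (k : B ≅ C) :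
    leIdealInclusions (f ≫ k.hom) ↔ leIdealInclusions f := by
  constructor
  · intro h
    have h1 := leIdealInclusions.comp_mem _ _ h (leIdealInclusions_of_isIso k.inv)
    rwa [Category.assoc, k.hom_inv_id, Category.comp_id] at h1
  · exact fun h => leIdealInclusions.comp_mem _ _ h (leIdealInclusions_of_isIso k.hom)

theorem leIdealInclusions_iso_comp_iff {A B C : RSkewAlg.{u}} (k : A ≅ B) (f : B ⟶ C) :
    leIdealInclusions (k.hom ≫ f) ↔ leIdealInclusions f := by
  constructor
  · intro h
    have h1 := leIdealInclusions.comp_mem _ _ (leIdealInclusions_of_isIso k.inv) h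
    rwa [Iso.inv_hom_id_assoc] at h1
  · exact fun h => leIdealInclusions.comp_mem _ _ (leIdealInclusions_of_isIso k.hom) h

theorem leIdealInclusions_idealIncl (A : RSkewAlg.{u}) (I : LeIdeal A) :
    leIdealInclusions (idealIncl A I) := ⟨I, Iso.refl _, (Category.id_comp _).symm⟩

/-- The forward direction is `map_partialId` up to isomorphism. Conversely, the ideal presented by
the image of `m` comes from an open `U`, so `m` and the partial identity on `U` have the same image
up to an isomorphism of the source, which full faithfulness lifts to spaces. -/
theorem partialIdentities_iff_map {X Y : SkewBoolSp.{u}} (m : X ⟶ Y) :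
    partialIdentities m ↔ leIdealInclusions (sectionFunctor.map m.op) := by
  constructor
  · rintro ⟨U, k, rfl⟩
    obtain ⟨k', hk'⟩ := map_partialId X U
    rw [op_comp, Functor.map_comp, hk']
    exact (leIdealInclusions_iso_comp_iff (sectionFunctor.mapIso k.op) _).2
      ((leIdealInclusions_iso_comp_iff _ _).2 (leIdealInclusions_idealIncl _ _))
  · intro h
    obtain ⟨I, k, hk⟩ : ∃ (I : LeIdeal (sectionAlg X)) (k : sectionAlg Y ≅ idealObj _ I),
      sectionFunctor.map m.op = k.hom ≫ idealIncl _ I := h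
    obtain ⟨U, rfl⟩ := (idealOfOpen_bijective X).2 I
    obtain ⟨k', hk'⟩ := map_partialId X U
    have : (sectionFunctor.{u}).Full := inferInstanceAs duality.functor.Full
    have : (sectionFunctor.{u}).Faithful := inferInstanceAs duality.functor.Faithful
    -- By contravariance the isomorphism of sources lifts to one of targets, `j.unop : restrictObj X
    -- U ≅ Y`.
    let j : op Y ≅ op (restrictObj X U) := sectionFunctor.preimageIso (k ≪≫ k'.symm)
    have hj : sectionFunctor.map j.hom = k.hom ≫ k'.inv := by
      rw [Functor.preimageIso_hom, Functor.map_preimage]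
      rfl
    refine ⟨U, j.unop, Quiver.Hom.op_inj (sectionFunctor.map_injective ?_)⟩
    have e : k.hom ≫ idealIncl _ (idealOfOpen X U) =
        (k.hom ≫ k'.inv) ≫ k'.hom ≫ idealIncl _ (idealOfOpen X U) := by
      rw [Category.assoc, Iso.inv_hom_id_assoc]
    rw [op_comp, Functor.map_comp]
    exact hk.trans (e.trans (congrArg₂ (· ≫ ·) hj hk').symm)

/-- By naturality of `basicIso`, `f` agrees with its double dual up to isomorphisms at both ends,
which the class of ideal inclusions ignores; `partialIdentities_iff_map` then applies to the dual of
`f`. -/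
theorem leIdealInclusions_iff_map {A A' : RSkewAlg.{u}} (f : A ⟶ A') :
    leIdealInclusions f ↔
      partialIdentities ((spectrumFunctor spectrumIsFunctor).map f.op) := by
  rw [partialIdentities_iff_map]
  exact (leIdealInclusions_comp_iso_iff f (basicIso A')).symm.trans
    ((Eq.to_iff (congrArg (fun g => leIdealInclusions g) (basicHom_naturality f))).trans
      (leIdealInclusions_iso_comp_iff (basicIso A) _))

theorem partialIdentities_of_isIso {X Y : SkewBoolSp.{u}} (m : X ⟶ Y) [IsIso m] :
    partialIdentities m :=
  (partialIdentities_iff_map m).2 (leIdealInclusions_of_isIso _)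

/-! ## The restricted duality -/

/-- The functor of copen sections on partial identities. -/
def wideSectionFunctor : (WideSubcategory partialIdentities.{u})ᵒᵖ ⥤
    WideSubcategory leIdealInclusions.{u} where
  obj X := ⟨sectionFunctor.obj (op X.unop.obj)⟩
  map m := ⟨sectionFunctor.map m.unop.hom.op, (partialIdentities_iff_map _).1 m.unop.property⟩
  map_id X := WideSubcategory.hom_ext _ (sectionFunctor.map_id (op X.unop.obj))
  map_comp m n := WideSubcategory.hom_ext _ (sectionFunctor.map_comp m.unop.hom.op n.unop.hom.op)

/-- The skew spectrum functor on inclusions of ideals. -/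
noncomputable def wideSpectrumFunctor : WideSubcategory leIdealInclusions.{u} ⥤
    (WideSubcategory partialIdentities.{u})ᵒᵖ where
  obj A := op ⟨Spec A.obj⟩
  map f := Quiver.Hom.op ⟨(spectrumFunctor spectrumIsFunctor).map f.hom.op,
    (leIdealInclusions_iff_map _).1 f.property⟩
  map_id A := Quiver.Hom.unop_inj (WideSubcategory.hom_ext _
    ((spectrumFunctor spectrumIsFunctor).map_id (op A.obj)))
  map_comp f g := Quiver.Hom.unop_inj (WideSubcategory.hom_ext _
    ((spectrumFunctor spectrumIsFunctor).map_comp g.hom.op f.hom.op))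

/-- The duality between partial identities and inclusions of ideals. -/
noncomputable def wideDuality : (WideSubcategory partialIdentities.{u})ᵒᵖ ≌
    WideSubcategory leIdealInclusions.{u} :=
  CategoryTheory.Equivalence.mk wideSectionFunctor wideSpectrumFunctor
    -- Isomorphisms belong to both classes, so the components of the full duality lie in the wide
    -- subcategories, where their naturality squares are unchanged.
    (Iso.symm (NatIso.ofComponents
      (fun X => (WideSubcategory.isoMk (pointIso X.unop.obj) (partialIdentities_of_isIso _)
        (partialIdentities_of_isIso _) : X.unop ≅ ⟨Spec (sectionAlg X.unop.obj)⟩).op)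
      fun {_ _} f => Quiver.Hom.unop_inj
        (WideSubcategory.hom_ext _ (pointIso_naturality f.unop.hom))))
    (Iso.symm (NatIso.ofComponents
      (fun A => (WideSubcategory.isoMk (basicIso A.obj) (leIdealInclusions_of_isIso _)
        (leIdealInclusions_of_isIso _) : A ≅ ⟨sectionAlg (Spec A.obj)⟩))
      fun f => WideSubcategory.hom_ext _ (basicHom_naturality f.hom)))

/-! ## Ideals and open subsets of the skew spectrum -/

/-- The inverse image of an ideal under a homomorphism. -/
def LeIdeal.comap {A B : RSkewAlg.{u}} (f : A ⟶ B) (I : LeIdeal B) : LeIdeal A where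
  carrier := SkewHom.toFun f ⁻¹' I.carrier
  zero_mem := by rw [Set.mem_preimage, SkewHom.map_zero f]; exact I.zero_mem
  join_mem hx hy := by rw [Set.mem_preimage, SkewHom.map_join f]; exact I.join_mem hx hy
  lower h hy := I.lower (h.map f) hy

theorem mem_openOfIdeal {A : RSkewAlg.{u}} {I : LeIdeal A} {x : SkewSpectrum A} :
    x ∈ openOfIdeal I ↔ ∃ a ∈ I.carrier, a ∈ x.cls :=
  Set.mem_iUnion₂.trans (by simp only [exists_prop, mem_basicM])

/-- Transported along `a ↦ M_a`, the ideal `I` becomes an ideal of copen sections whose union is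
`openOfIdeal I`, so `idealOfOpen_openOfSections` recovers it. -/
theorem comap_openOfIdeal {A : RSkewAlg.{u}} (I : LeIdeal A) :
    (idealOfOpen (Spec A) (openOfIdeal I)).comap (basicHom A) = I := by
  have h : openOfIdeal I = openOfSections (X := Spec A) (I.comap (basicIso A).inv) := by
    ext x
    refine mem_openOfIdeal.trans (Iff.trans ?_ mem_openOfSections.symm)
    have hinv : ∀ a : A, SkewHom.toFun (basicIso A).inv (basicSection a) = a :=
      fun a => congrFun (congrArg SkewHom.toFun (basicIso A).hom_inv_id) a
    constructor
    · rintro ⟨a, ha, hx⟩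
      refine ⟨basicSection a, ?_, mem_basicM.2 hx⟩
      change SkewHom.toFun (basicIso A).inv (basicSection a) ∈ I.carrier
      rwa [hinv]
    · rintro ⟨S, hS, hx⟩
      obtain ⟨a, rfl⟩ := basicSection_bijective.2 S
      change SkewHom.toFun (basicIso A).inv (basicSection a) ∈ I.carrier at hS
      rw [hinv] at hS
      exact ⟨a, hS, mem_basicM.1 hx⟩
  rw [h, idealOfOpen_openOfSections]
  refine LeIdeal.ext ?_
  change SkewHom.toFun (basicHom A) ⁻¹' (SkewHom.toFun (basicIso A).inv ⁻¹' I.carrier) = I.carrier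
  rw [← Set.preimage_comp]
  exact congrArg (fun f => SkewHom.toFun f ⁻¹' I.carrier) (basicIso A).hom_inv_id

theorem mem_iff_basicM_subset {A : RSkewAlg.{u}} {I : LeIdeal A} {a : A} :
    a ∈ I.carrier ↔ basicM a ⊆ openOfIdeal I := by
  conv_lhs => rw [← comap_openOfIdeal I]
  exact Iff.rfl

theorem openOfIdeal_le_iff {A : RSkewAlg.{u}} {I J : LeIdeal A} :
    openOfIdeal I ≤ openOfIdeal J ↔ I ≤ J := by
  constructor
  · exact fun h a ha => mem_iff_basicM_subset.2 ((mem_iff_basicM_subset.1 ha).trans h)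
  · intro h x hx
    obtain ⟨a, ha, hxa⟩ := mem_openOfIdeal.1 hx
    exact mem_openOfIdeal.2 ⟨a, h ha, hxa⟩

theorem openOfIdeal_bijective (A : RSkewAlg.{u}) :
    Function.Bijective (openOfIdeal (A := A)) := by
  constructor
  · intro I J h
    rw [← comap_openOfIdeal I, h, comap_openOfIdeal]
  · intro U
    -- The ideal of the elements `a` with `M_a ⊆ U`; its union is `U` because the sets `M_a` form a
    -- basis.
    refine ⟨(idealOfOpen (Spec A) U).comap (basicHom A), ?_⟩
    ext x
    refine mem_openOfIdeal.trans ⟨?_, fun hx => ?_⟩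
    · rintro ⟨a, ha, hx⟩
      exact ha (mem_basicM.2 hx)
    · obtain ⟨_, ⟨a, rfl⟩, hxa, haU⟩ :=
        isTopologicalBasis_basicM.exists_subset_of_mem_open hx U.isOpen
      exact ⟨a, haU, mem_basicM.1 hxa⟩

/-- The matching of the two classes already gives a partial identity on some open `U`. This `U` has
to be the domain of `f^↑` for the inclusion, which consists of the points whose class meets `I`. -/
theorem map_idealIncl (A : RSkewAlg.{u}) (I : LeIdeal A) :
    ∃ k : restrictObj (Spec A) (openOfIdeal I) ≅ Spec (idealObj A I),
      (spectrumFunctor spectrumIsFunctor).map (idealIncl A I).op =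
        partialId (Spec A) (openOfIdeal I) ≫ k.hom := by
  obtain ⟨U, k, hk⟩ : ∃ (U : Opens (SkewSpectrum A)) (k : restrictObj (Spec A) U ≅
      Spec (idealObj A I)), (spectrumFunctor spectrumIsFunctor).map (idealIncl A I).op =
        partialId (Spec A) U ≫ k.hom := (leIdealInclusions_iff_map _).1 (leIdealInclusions_idealIncl A I)
  have hU : U = openOfIdeal I := by
    ext x
    refine Iff.trans ?_ mem_openOfIdeal.symm
    have h1 : (∃ a ∈ I.carrier, a ∈ x.cls) ↔ ∃ y, y ∈ upMap (idealIncl A I) x := by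
      constructor
      · rintro ⟨a, ha, hx⟩
        exact ⟨_, mk'_mem_upMap (A := idealObj A I) (A' := A) (idealIncl A I) (a := ⟨a, ha⟩) hx⟩
      · rintro ⟨y, hy⟩
        obtain ⟨a, ha⟩ := SkewSpectrum.exists_mem_cls (A := idealObj A I) y
        exact ⟨a.1, a.2, ((mem_upMap (A := idealObj A I) (A' := A) (idealIncl A I)).1 hy a).1 ha⟩
    have h2 : ∀ y, y ∈ upMap (idealIncl A I) x ↔
        ∃ z, z ∈ partialIdMap (U : Set (SkewSpectrum A)) x ∧ y ∈ SpHom.top k.hom z := by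
      intro y
      exact (Eq.to_iff (congrArg
        (fun m : Spec A ⟶ Spec (idealObj A I) => (y : (Spec (idealObj A I)).E) ∈ SpHom.top m x) hk)).trans
        (mem_comp_top (partialId (Spec A) U) k.hom x y)
    rw [h1]
    simp only [h2]
    constructor
    · intro hx
      have h3 : (⟨x, hx⟩ : (U : Set (SkewSpectrum A))) ∈ SpHom.top (k.hom ≫ k.inv) ⟨x, hx⟩ := by
        rw [k.hom_inv_id]
        exact (mem_id _ _).2 rfl
      obtain ⟨y, hy, -⟩ := (mem_comp_top _ _ _ _).1 h3
      exact ⟨y, _, (mem_partialIdMap _ _ _).2 rfl, hy⟩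
    · rintro ⟨y, z, hz, -⟩
      exact (mem_partialIdMap _ _ _).1 hz ▸ z.2
  subst hU
  exact ⟨k, hk⟩

end SkewStone

/-! ### The main theorem -/

theorem mainTheorem8 :
    ∃ hS : SkewStone.SpectrumIsFunctor.{u},
      -- the duality, with copen sections in one direction and skew spectra in the other
      (∃ e : SkewStone.SkewBoolSp.{u}ᵒᵖ ≌ SkewStone.RSkewAlg.{u},
        e.functor = SkewStone.sectionFunctor ∧
        e.inverse = (SkewStone.spectrumFunctor hS).rightOp) ∧
      -- both functors match partial identities with inclusions of ≤-ideals
      (∀ {X Y : SkewStone.SkewBoolSp.{u}} (m : X ⟶ Y),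
        SkewStone.partialIdentities m ↔
          SkewStone.leIdealInclusions (SkewStone.sectionFunctor.map m.op)) ∧
      (∀ {A A' : SkewStone.RSkewAlg.{u}} (f : A ⟶ A'),
        SkewStone.leIdealInclusions f ↔
          SkewStone.partialIdentities ((SkewStone.spectrumFunctor hS).map f.op)) ∧
      -- they restrict to a duality of the two wide subcategories
      (∃ e : (WideSubcategory SkewStone.partialIdentities.{u})ᵒᵖ ≌
          WideSubcategory SkewStone.leIdealInclusions.{u},
        e.functor ⋙ wideSubcategoryInclusion _ =
          (wideSubcategoryInclusion _).op ⋙ SkewStone.sectionFunctor ∧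
        e.inverse ⋙ (wideSubcategoryInclusion _).op =
          wideSubcategoryInclusion _ ⋙ (SkewStone.spectrumFunctor hS).rightOp) ∧
      -- the partial identity on an open U is dual to the inclusion of the ≤-ideal of the copen
      -- sections contained in U, and this is an order isomorphism of opens and ≤-ideals
      (∀ X : SkewStone.SkewBoolSp.{u},
        (∀ U : Opens X.E, ∃ k : SkewStone.sectionAlg (SkewStone.restrictObj X U) ≅
            SkewStone.idealObj (SkewStone.sectionAlg X) (SkewStone.idealOfOpen X U),
          SkewStone.sectionFunctor.map (SkewStone.partialId X U).op =
            k.hom ≫ SkewStone.idealIncl _ (SkewStone.idealOfOpen X U)) ∧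
        (∀ U V : Opens X.E, SkewStone.idealOfOpen X U ≤ SkewStone.idealOfOpen X V ↔ U ≤ V) ∧
        Function.Bijective (SkewStone.idealOfOpen X)) ∧
      -- the inclusion of a ≤-ideal I is dual to the partial identity on the union of the basic
      -- open sets of the elements of I, and this is an order isomorphism of ≤-ideals and opens
      (∀ A : SkewStone.RSkewAlg.{u},
        (∀ I : SkewStone.LeIdeal A,
          ∃ k : SkewStone.restrictObj ((SkewStone.spectrumFunctor hS).obj (op A))
              (SkewStone.openOfIdeal I) ≅
              (SkewStone.spectrumFunctor hS).obj (op (SkewStone.idealObj A I)),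
            (SkewStone.spectrumFunctor hS).map (SkewStone.idealIncl A I).op =
              SkewStone.partialId _ (SkewStone.openOfIdeal I) ≫ k.hom) ∧
        (∀ I J : SkewStone.LeIdeal A,
          SkewStone.openOfIdeal I ≤ SkewStone.openOfIdeal J ↔ I ≤ J) ∧
        Function.Bijective (SkewStone.openOfIdeal (A := A))) := by
  exact ⟨SkewStone.spectrumIsFunctor, ⟨SkewStone.duality, rfl, rfl⟩,
    SkewStone.partialIdentities_iff_map, SkewStone.leIdealInclusions_iff_map,
    ⟨SkewStone.wideDuality, rfl, rfl⟩,
    fun X => ⟨SkewStone.map_partialId X, fun _ _ => SkewStone.idealOfOpen_le_iff,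
      SkewStone.idealOfOpen_bijective X⟩,
    fun A => ⟨SkewStone.map_idealIncl A, fun _ _ => SkewStone.openOfIdeal_le_iff,
      SkewStone.openOfIdeal_bijective A⟩⟩
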